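/- Setting. Let $\mathbb S=\mathbb R/\mathbb Z$, let $f:\mathbb R^n\times\mathbb R^q\to\mathbb R^n$ be $C^1$, let $\rho$ be irrational, $T\in\mathbb R$, $p\in\mathbb R^q$, and let $v$ be a $C^1$ solution of the torus problem $$\partial_\tau v=Tf(v,p),\qquad v(\phi,1)=v(\phi+\rho,0)\qquad(\phi\in\mathbb S,\ \tau\in[0,1]),$$ extended to $\mathbb S\times\mathbb R$ by $v(\phi,\tau+1)=v(\phi+\rho,\tau)$. Let $V$ solve $\partial_\tau V=T\,\partial_xf(v,p)V$, $V(\cdot,0)=I$, and put $P(\phi,\tau)=T\,V(\phi,\tau)\int_0^\tau V(\phi,\sigma)^{-1}\partial_pf(v(\phi,\sigma),p)\,d\sigma$ and $$\Gamma_{\rho,\tau}[w](\phi)=V(\phi-\rho,\tau+1)V(\phi-\rho,\tau)^{-1}w(\phi-\rho)-w(\phi).$$ Assume that $v$ is normally hyperbolic: $\partial_\tau v,\partial_\phi v$ are pointwise linearly independent, and there are continuous row-vector fields $q_\tau^{\mathsf T},q_\phi^{\mathsf T}$ on $\mathbb S\times\mathbb R$ such that $q_{\rm tg}=\partial_\tau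 v\,q_\tau^{\mathsf T}+\partial_\phi v\,q_\phi^{\mathsf T}$ is pointwise a projection onto $\operatorname{span}\{\partial_\tau v,\partial_\phi v\}$, $q_{\rm tg}(\phi,\tau+1)=q_{\rm tg}(\phi+\rho,\tau)$, $q_{\rm tg}(\phi,\tau)V(\phi,\tau)=V(\phi,\tau)q_{\rm tg}(\phi,0)$, and each $\Gamma_{\rho,\tau}$ is a bijection with bounded inverse (sup-norm) on the space of functions $\phi\mapsto(I-q_{\rm tg}(\phi,\tau))\delta(\phi)$, $\delta\in C(\mathbb S,\mathbb R^n)$. Let $h=(h_1,h_2)$ be phase conditions with $h(v,p)=0$ that are differentiable at $(v,p)$ along $C^1$ directions with derivative $\int_{\mathbb S}\int_0^1\partial_vh\,\delta_v\,d\tau\,d\phi+\partial_ph\,\delta_p$, where $\partial_vh$ is a continuous density on $\mathbb S\times[0,1]$, and such that the $2\times2$ matrix $\int_{\mathbb S}\int_0^1\partial_vh\,[\partial_\tau v\ \ \partial_\phi v]\,d\tau\,d\phi$ is nonsingular. Let $X$ be the space of $(\delta_v,\delta_T,\delta_\rho,\delta_p)$ with $\delta_v,\partial_\tau\delta_v$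 continuous on $\mathbb S\times[0,1]$, normed by the maximum of $\|\delta_v\|_\infty,\|\partial_\tau\delta_v\|_\infty,|\delta_T|,|\delta_\rho|,|\delta_p|$. Let $L_0$ be the linearized zero problem $(\delta_v,\delta_T,\delta_\rho,\delta_p)\mapsto(\delta_{\rm ode},\delta_{\rm bc},\delta_h)\in C(\mathbb S\times[0,1],\mathbb R^n)\times C(\mathbb S,\mathbb R^n)\times\mathbb R^2$ (sup-norms), $$\delta_{\rm ode}=\partial_\tau\delta_v-T\partial_xf(v,p)\delta_v-f(v,p)\delta_T-T\partial_pf(v,p)\delta_p,$$ $$\delta_{\rm bc}=\delta_v(\cdot+\rho,0)-\delta_v(\cdot,1)+\partial_\phi v(\cdot+\rho,0)\delta_\rho,\qquad \delta_h=\int_{\mathbb S}\int_0^1\partial_vh\,\delta_v\,d\tau\,d\phi+\partial_ph\,\delta_p,$$ let $L=(L_0,\delta_p)$ be the linearization of the reduced problem in which $p$ is prescribed, and put $\delta_{\rm rhs}(\phi)=\delta_{\rm bc}(\phi)+V(\phi,1)\int_0^1V(\phi,\sigma)^{-1}\delta_{\rm ode}(\phi,\sigma)\,d\sigma$. Theorem.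 (1) The small divisors $1-e^{-2\pi ik\rho}$, $k\in\mathbb Z\setminus\{0\}$, are nonzero and arbitrarily small. For every element of $X$, every $k\neq0$, and $r=q_\tau$ or $r=q_\phi$, the $k$-th Fourier coefficient of $r^{\mathsf T}(\phi,0)\delta_v(\phi,0)$ multiplied by $1-e^{-2\pi ik\rho}$ equals the $k$-th Fourier coefficient of $r^{\mathsf T}(\phi,0)\bigl(\delta_{\rm rhs}(\phi-\rho)+P(\phi-\rho,1)\delta_p\bigr)$. (2) $L$ is injective with dense range, but has no bounded inverse; indeed for every $C$ there is an element of $X$ with $\delta_v$ of class $C^1$, $\|L(\delta_v,\delta_T,\delta_\rho,\delta_p)\|\le1$ and $\|\delta_v\|_\infty>C$. Moreover, for no $d$ and no bounded linear $\psi:X\to\mathbb R^d$ does $(L_0,\psi)$ have a bounded inverse. (3) For every element of $X$, $$\int_{\mathbb S}q_\tau^{\mathsf T}(\phi-\rho,1)\delta_{\rm rhs}(\phi-\rho)\,d\phi+\int_{\mathbb S}q_\tau^{\mathsf T}(\phi-\rho,1)P(\phi-\rho,1)\,d\phi\;\delta_p=-\frac{\delta_T}{T},$$ $$\int_{\mathbb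 S}q_\phi^{\mathsf T}(\phi-\rho,1)\delta_{\rm rhs}(\phi-\rho)\,d\phi+\int_{\mathbb S}q_\phi^{\mathsf T}(\phi-\rho,1)P(\phi-\rho,1)\,d\phi\;\delta_p=\delta_\rho .$$ (4) Consider the adjoint conditions for $(\lambda_{\rm de},\lambda_{\rm bc},\lambda_{\rm ps},\eta_p)$ with $\lambda_{\rm bc}$ continuous and given $(\eta_T,\eta_\rho)$: $$0=-\partial_\tau\lambda_{\rm de}^{\mathsf T}-T\lambda_{\rm de}^{\mathsf T}\partial_xf(v,p)+\lambda_{\rm ps}^{\mathsf T}\partial_vh,\quad \lambda_{\rm de}(\phi,1)=\lambda_{\rm bc}(\phi),\quad \lambda_{\rm de}(\phi,0)=\lambda_{\rm bc}(\phi-\rho),$$ $$0=-\int_{\mathbb S}\int_0^1\lambda_{\rm de}^{\mathsf T}f(v,p)\,d\tau\,d\phi+\eta_T,\qquad 0=\int_{\mathbb S}\lambda_{\rm bc}^{\mathsf T}(\phi)\,\partial_\phi v(\phi+\rho,0)\,d\phi+\eta_\rho,$$ $$0=-\int_{\mathbb S}\int_0^1T\lambda_{\rm de}^{\mathsf T}\partial_pf(v,p)\,d\tau\,d\phi+\eta_p^{\mathsf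 T}+\lambda_{\rm ps}^{\mathsf T}\partial_ph .$$ For $(\eta_T,\eta_\rho)=(1,0)$ the unique solution on $\mathbb S\times[0,1]$ is $\lambda_{\rm de}=Tq_\tau$, $\lambda_{\rm bc}=Tq_\tau(\cdot,1)$, $\lambda_{\rm ps}=0$, $\eta_p^{\mathsf T}=T\int_{\mathbb S}q_\tau^{\mathsf T}(\phi,1)P(\phi,1)\,d\phi$. For $(\eta_T,\eta_\rho)=(0,1)$ it is $\lambda_{\rm de}=-q_\phi$, $\lambda_{\rm bc}=-q_\phi(\cdot,1)$, $\lambda_{\rm ps}=0$, $\eta_p^{\mathsf T}=-\int_{\mathbb S}q_\phi^{\mathsf T}(\phi,1)P(\phi,1)\,d\phi$. (5) The rows of the inverse of $L$ giving $\delta_T$ and $\delta_\rho$ are bounded: there are bounded linear functionals $R_T,R_\rho$ on the data space with $R_T(Lx)=\delta_T$ and $R_\rho(Lx)=\delta_\rho$ for all $x=(\delta_v,\delta_T,\delta_\rho,\delta_p)\in X$. They are the adjoint sensitivities: for all data, $$R_{T}\ (\text{resp. }R_\rho)\;=\;-\int_{\mathbb S}\int_0^1\lambda_{\rm de}^{\mathsf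 T}\delta_{\rm ode}\,d\tau\,d\phi-\int_{\mathbb S}\lambda_{\rm bc}^{\mathsf T}\delta_{\rm bc}\,d\phi-\lambda_{\rm ps}^{\mathsf T}\delta_h-\eta_p^{\mathsf T}\delta_p$$ with the adjoint solution for $(\eta_T,\eta_\rho)=(1,0)$ (resp. $(0,1)$). In particular, data with only $\delta_p\ne0$ give $R_T=-\eta_p^{\mathsf T}\delta_p$ with $\eta_p^{\mathsf T}=T\int_{\mathbb S}q_\tau^{\mathsf T}(\phi,1)P(\phi,1)\,d\phi$ and $R_\rho=-\eta_p^{\mathsf T}\delta_p$ with $\eta_p^{\mathsf T}=-\int_{\mathbb S}q_\phi^{\mathsf T}(\phi,1)P(\phi,1)\,d\phi$, and data with only $\delta_h\ne0$ give $R_T=R_\rho=0$. -/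

import Mathlib

open MeasureTheory Set

namespace QPTorus

/-- The circle `ℝ / ℤ`, of total length one. -/
abbrev Circ := UnitAddCircle

/-- The Euclidean space `ℝⁿ` (column vectors). -/
abbrev Vec (n : ℕ) := EuclideanSpace ℝ (Fin n)

/-- Row vectors, i.e. linear functionals on `ℝⁿ`. -/
abbrev Cov (n : ℕ) := Vec n →L[ℝ] ℝ

/-- The cylinder `𝕊 × [0,1]`. -/
abbrev Strip := Circ × unitInterval

variable {n q : ℕ}

/-- `∂_φ v (φ, τ)`. -/
noncomputable def dphi (v : Circ → ℝ → Vec n) (φ : Circ) (τ : ℝ) : Vec n :=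
  deriv (fun s : ℝ => v (φ + (s : Circ)) τ) 0

/-- `∂_τ v (φ, τ)`. -/
noncomputable def dtau (v : Circ → ℝ → Vec n) (φ : Circ) (τ : ℝ) : Vec n :=
  deriv (v φ) τ

/-- Continuous differentiability of a function of `(φ, τ) ∈ 𝕊 × ℝ`. -/
def IsC1 (v : Circ → ℝ → Vec n) : Prop :=
  ContDiff ℝ 1 (fun z : ℝ × ℝ => v (z.1 : Circ) z.2)

/-- Continuous differentiability of a vector field depending on parameters. -/
def IsC1Field (f : Vec n → Vec q → Vec n) : Prop :=
  ContDiff ℝ 1 (fun z : Vec n × Vec q => f z.1 z.2)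

/-- `∂_x f (x, p)`. -/
noncomputable def dx (f : Vec n → Vec q → Vec n) (x : Vec n) (p : Vec q) : Vec n →L[ℝ] Vec n :=
  fderiv ℝ (fun y => f y p) x

/-- `∂_p f (x, p)`. -/
noncomputable def dp (f : Vec n → Vec q → Vec n) (x : Vec n) (p : Vec q) : Vec q →L[ℝ] Vec n :=
  fderiv ℝ (f x) p

/-- `v` is a continuously differentiable solution of the torus boundary-value problem
`∂_τ v = T f(v, p)`, `v(φ, 1) = v(φ + ρ, 0)` on `𝕊 × [0,1]`. Such a solution extends uniquely to
`𝕊 × ℝ` as a solution with `v(φ, τ + 1) = v(φ + ρ, τ)`, and `v` stands for this extension. -/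
structure IsTorusSolution (f : Vec n → Vec q → Vec n) (T ρ : ℝ) (p : Vec q)
    (v : Circ → ℝ → Vec n) : Prop where
  c1 : IsC1 v
  ode : ∀ φ τ, HasDerivAt (v φ) (T • f (v φ τ) p) τ
  bc : ∀ φ τ, v φ (τ + 1) = v (φ + (ρ : Circ)) τ

/-- `V` is the solution of the variational initial-value problem
`∂_τ V = T ∂_x f(v, p) V`, `V(·, 0) = I`. -/
structure IsVariationalSolution (f : Vec n → Vec q → Vec n) (T : ℝ) (p : Vec q)
    (v : Circ → ℝ → Vec n) (V : Circ → ℝ → Vec n →L[ℝ] Vec n) : Prop where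
  init : ∀ φ, V φ 0 = ContinuousLinearMap.id ℝ (Vec n)
  ode : ∀ φ τ, HasDerivAt (V φ) (T • (dx f (v φ τ) p).comp (V φ τ)) τ

/-- `Γ_{ρ,τ}[w](φ) = V(φ - ρ, τ + 1) V(φ - ρ, τ)⁻¹ w(φ - ρ) - w(φ)`. -/
noncomputable def Gam (ρ : ℝ) (V : Circ → ℝ → Vec n →L[ℝ] Vec n) (τ : ℝ) (w : Circ → Vec n)
    (φ : Circ) : Vec n :=
  V (φ - (ρ : Circ)) (τ + 1) ((V (φ - (ρ : Circ)) τ).inverse (w (φ - (ρ : Circ)))) - w φ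

/-- `q_tg = ∂_τ v q_τᵀ + ∂_φ v q_φᵀ`. -/
noncomputable def qtg (v : Circ → ℝ → Vec n) (qτ qφ : Circ → ℝ → Cov n) (φ : Circ) (τ : ℝ) :
    Vec n →L[ℝ] Vec n :=
  (qτ φ τ).smulRight (dtau v φ τ) + (qφ φ τ).smulRight (dphi v φ τ)

/-- `q_tr = I - q_tg`. -/
noncomputable def qtr (v : Circ → ℝ → Vec n) (qτ qφ : Circ → ℝ → Cov n) (φ : Circ) (τ : ℝ) :
    Vec n →L[ℝ] Vec n :=
  ContinuousLinearMap.id ℝ (Vec n) - qtg v qτ qφ φ τ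

/-- The functions `φ ↦ q_tr(φ, τ) δ(φ)` with `δ` continuous on the circle. -/
def IsTransversal (v : Circ → ℝ → Vec n) (qτ qφ : Circ → ℝ → Cov n) (τ : ℝ)
    (w : C(Circ, Vec n)) : Prop :=
  ∃ δ : C(Circ, Vec n), ∀ φ, w φ = qtr v qτ qφ φ τ (δ φ)

/-- Normal hyperbolicity of `v`, with tangential projections `q_tg = ∂_τ v q_τᵀ + ∂_φ v q_φᵀ`:
a continuous invariant family of projections onto the (two-dimensional) tangent spaces, such that
every `Γ_{ρ,τ}` is a bijection with bounded inverse on the space of transversal perturbations. -/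
structure IsNormallyHyperbolic (ρ : ℝ) (v : Circ → ℝ → Vec n)
    (V : Circ → ℝ → Vec n →L[ℝ] Vec n) (qτ qφ : Circ → ℝ → Cov n) : Prop where
  cont_qτ : Continuous fun z : Circ × ℝ => qτ z.1 z.2
  cont_qφ : Continuous fun z : Circ × ℝ => qφ z.1 z.2
  indep : ∀ φ τ, LinearIndependent ℝ ![dtau v φ τ, dphi v φ τ]
  proj : ∀ φ τ, (qtg v qτ qφ φ τ).comp (qtg v qτ qφ φ τ) = qtg v qτ qφ φ τ
  range_eq : ∀ φ τ, Set.range (qtg v qτ qφ φ τ) =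
    (Submodule.span ℝ {dtau v φ τ, dphi v φ τ} : Submodule ℝ (Vec n))
  shift : ∀ φ τ, qtg v qτ qφ φ (τ + 1) = qtg v qτ qφ (φ + (ρ : Circ)) τ
  invariant : ∀ φ τ, (qtg v qτ qφ φ τ).comp (V φ τ) = (V φ τ).comp (qtg v qτ qφ φ 0)
  bijective : ∀ τ : ℝ, ∃ C : ℝ, ∀ g : C(Circ, Vec n), IsTransversal v qτ qφ τ g →
    ∃ w : C(Circ, Vec n), IsTransversal v qτ qφ τ w ∧ (∀ φ, Gam ρ V τ w φ = g φ) ∧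
      ‖w‖ ≤ C * ‖g‖ ∧
      ∀ w' : C(Circ, Vec n), IsTransversal v qτ qφ τ w' → (∀ φ, Gam ρ V τ w' φ = g φ) → w' = w

/-- The two phase conditions `h(v, p) = 0`: the functional `h` is differentiable at `(v, p)` along
continuously differentiable directions, with derivative
`∫_𝕊 ∫_0^1 ∂_v h (φ,τ) δ_v(φ,τ) dτ dφ + ∂_p h δ_p`, where `∂_v h = K` is a continuous row-vector
valued density and `∂_p h = H`, and the non-degeneracy matrix is nonsingular. -/
structure IsPhaseCondition (h : (Strip → Vec n) → Vec q → Fin 2 → ℝ) (p : Vec q)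
    (v : Circ → ℝ → Vec n) (K : Fin 2 → C(Strip, Cov n)) (H : Fin 2 → Cov q) : Prop where
  zero : h (fun z => v z.1 z.2) p = 0
  deriv_eq : ∀ w : Circ → ℝ → Vec n, IsC1 w → ∀ δp : Vec q, ∀ i : Fin 2,
    HasDerivAt (fun s : ℝ => h (fun z => v z.1 z.2 + s • w z.1 z.2) (p + s • δp) i)
      ((∫ φ : Circ, ∫ τ : unitInterval, K i (φ, τ) (w φ τ)) + H i δp) 0
  nondegenerate : (Matrix.of fun i : Fin 2 =>
    ![∫ φ : Circ, ∫ τ : unitInterval, K i (φ, τ) (dtau v φ τ),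
      ∫ φ : Circ, ∫ τ : unitInterval, K i (φ, τ) (dphi v φ τ)]).det ≠ 0

/-- `P(φ, τ) = T V(φ, τ) ∫_0^τ V(φ, σ)⁻¹ ∂_p f(v(φ, σ), p) dσ`. -/
noncomputable def PMat (f : Vec n → Vec q → Vec n) (T : ℝ) (p : Vec q) (v : Circ → ℝ → Vec n)
    (V : Circ → ℝ → Vec n →L[ℝ] Vec n) (φ : Circ) (τ : ℝ) : Vec q →L[ℝ] Vec n :=
  T • (V φ τ).comp (∫ σ in (0 : ℝ)..τ, (V φ σ).inverse.comp (dp f (v φ σ) p))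

/-- `δ_rhs(φ) = δ_bc(φ) + V(φ, 1) ∫_0^1 V(φ, σ)⁻¹ δ_ode(φ, σ) dσ`. -/
noncomputable def deltaRhs (V : Circ → ℝ → Vec n →L[ℝ] Vec n) (δode : C(Strip, Vec n))
    (δbc : C(Circ, Vec n)) (φ : Circ) : Vec n :=
  δbc φ + V φ 1 (∫ σ : unitInterval, (V φ σ).inverse (δode (φ, σ)))

/-- The Banach space of continuous `w : 𝕊 × [0,1] → ℝⁿ` with continuous `∂_τ w`, realised as the
pairs `(w, ∂_τ w)`, with the norm `max (‖w‖_∞) (‖∂_τ w‖_∞)`. -/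
def StripFun (n : ℕ) : Submodule ℝ (C(Strip, Vec n) × C(Strip, Vec n)) where
  carrier := {w | ∀ (φ : Circ) (τ : unitInterval),
    HasDerivWithinAt (fun s : ℝ => w.1 (φ, projIcc 0 1 zero_le_one s)) (w.2 (φ, τ))
      (Icc 0 1) (τ : ℝ)}
  add_mem' := fun ha hb φ τ => (ha φ τ).add (hb φ τ)
  zero_mem' := fun _ τ => hasDerivWithinAt_const (τ : ℝ) (Icc 0 1) (0 : Vec n)
  smul_mem' := fun c _ ha φ τ => (ha φ τ).const_smul c

/-- Variations `(δ_v, δ_T, δ_ρ, δ_p)` of the unknowns. -/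
abbrev Unknowns (n q : ℕ) := StripFun n × ℝ × ℝ × Vec q

/-- Constraint violations `(δ_ode, δ_bc, δ_h)`. -/
abbrev Violations (n : ℕ) := C(Strip, Vec n) × C(Circ, Vec n) × EuclideanSpace ℝ (Fin 2)

theorem IsC1.continuous {v : Circ → ℝ → Vec n} (hv : IsC1 v) :
    Continuous fun z : Circ × ℝ => v z.1 z.2 := by
  have hq : IsOpenQuotientMap (Prod.map (fun x : ℝ => (x : Circ)) (id : ℝ → ℝ)) :=
    (QuotientAddGroup.isOpenQuotientMap_mk).prodMap IsOpenQuotientMap.id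
  exact hq.isQuotientMap.continuous_iff.2 (ContDiff.continuous hv)

theorem IsC1.continuous_dphi {v : Circ → ℝ → Vec n} (hv : IsC1 v) (τ : ℝ) :
    Continuous fun φ : Circ => dphi v φ τ := by
  have hq : IsOpenQuotientMap (fun x : ℝ => (x : Circ)) := QuotientAddGroup.isOpenQuotientMap_mk
  refine hq.isQuotientMap.continuous_iff.2 ?_
  have hv' : ContDiff ℝ 1 (fun z : ℝ × ℝ => v (z.1 : Circ) z.2) := hv
  have h : ∀ x : ℝ, dphi v (x : Circ) τ =
      fderiv ℝ (fun z : ℝ × ℝ => v (z.1 : Circ) z.2) (x, τ) (1, 0) := by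
    intro x
    have h1 : HasDerivAt (fun s : ℝ => (x + s, τ)) ((1 : ℝ), (0 : ℝ)) 0 :=
      ((hasDerivAt_id (0 : ℝ)).const_add x).prodMk (hasDerivAt_const _ _)
    have h2 : HasFDerivAt (fun z : ℝ × ℝ => v (z.1 : Circ) z.2)
        (fderiv ℝ (fun z : ℝ × ℝ => v (z.1 : Circ) z.2) (x, τ)) (x + 0, τ) := by
      rw [add_zero]
      exact (hv'.differentiable (by norm_num) _).hasFDerivAt
    have h3 := h2.comp_hasDerivAt (0 : ℝ) h1
    simpa [dphi, Function.comp_def] using h3.deriv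
  have h' : ((fun φ : Circ => dphi v φ τ) ∘ fun x : ℝ => (x : Circ)) = fun x : ℝ =>
      fderiv ℝ (fun z : ℝ × ℝ => v (z.1 : Circ) z.2) (x, τ) (1, 0) := funext h
  have hpair : Continuous fun x : ℝ => (x, τ) := by fun_prop
  rw [h']
  exact ((hv'.continuous_fderiv (by norm_num)).comp hpair).clm_apply continuous_const

theorem IsC1Field.continuous_dx {f : Vec n → Vec q → Vec n} (hf : IsC1Field f) (p : Vec q) :
    Continuous fun x : Vec n => dx f x p := by
  have h : ContDiff ℝ 1 fun x : Vec n => f x p :=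
    ContDiff.comp (g := fun z : Vec n × Vec q => f z.1 z.2) hf
      (contDiff_id.prodMk contDiff_const)
  exact h.continuous_fderiv (by norm_num)

theorem IsC1Field.continuous_dp {f : Vec n → Vec q → Vec n} (hf : IsC1Field f) (p : Vec q) :
    Continuous fun x : Vec n => dp f x p := by
  have hf' : ContDiff ℝ 1 (fun z : Vec n × Vec q => f z.1 z.2) := hf
  have hpair : Continuous fun x : Vec n => (x, p) := by fun_prop
  have h : (fun x : Vec n => dp f x p) = fun x =>
      (fderiv ℝ (fun z : Vec n × Vec q => f z.1 z.2) (x, p)).comp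
        (ContinuousLinearMap.inr ℝ (Vec n) (Vec q)) := by
    funext x
    have h2 : HasFDerivAt (fun z : Vec n × Vec q => f z.1 z.2) _ (x, p) :=
      (hf'.differentiable (by norm_num) (x, p)).hasFDerivAt
    exact (h2.comp p (hasFDerivAt_prodMk_right x p)).fderiv
  rw [h]
  exact ((hf'.continuous_fderiv (by norm_num)).comp hpair).clm_comp continuous_const

theorem IsC1Field.continuous {f : Vec n → Vec q → Vec n} (hf : IsC1Field f) (p : Vec q) :
    Continuous fun x : Vec n => f x p :=
  (ContDiff.continuous (f := fun z : Vec n × Vec q => f z.1 z.2) hf).comp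
    (continuous_id.prodMk continuous_const)

/-- The first linearized equation:
`δ_ode = ∂_τ δ_v - T ∂_x f(v,p) δ_v - f(v,p) δ_T - T ∂_p f(v,p) δ_p`. -/
noncomputable def linOde {f : Vec n → Vec q → Vec n} (hf : IsC1Field f) (T : ℝ) (p : Vec q)
    {v : Circ → ℝ → Vec n} (hv : IsC1 v) (x : Unknowns n q) : C(Strip, Vec n) where
  toFun z := x.1.1.2 z - T • dx f (v z.1 z.2) p (x.1.1.1 z) - x.2.1 • f (v z.1 z.2) p
    - T • dp f (v z.1 z.2) p x.2.2.2
  continuous_toFun := by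
    have h0 : Continuous fun z : Strip => v z.1 z.2 :=
      hv.continuous.comp (continuous_fst.prodMk (continuous_subtype_val.comp continuous_snd))
    have h1 := (hf.continuous_dx p).comp h0
    have h2 := (hf.continuous_dp p).comp h0
    have h3 := (hf.continuous p).comp h0
    have h4 := h1.clm_apply (map_continuous x.1.1.1)
    have h5 := h2.clm_apply (continuous_const (y := x.2.2.2))
    exact (((map_continuous x.1.1.2).sub (h4.const_smul T)).sub (h3.const_smul x.2.1)).sub
      (h5.const_smul T)

/-- The second linearized equation:
`δ_bc = δ_v(· + ρ, 0) - δ_v(·, 1) + ∂_φ v(· + ρ, 0) δ_ρ`. -/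
noncomputable def linBc (ρ : ℝ) {v : Circ → ℝ → Vec n} (hv : IsC1 v) (x : Unknowns n q) :
    C(Circ, Vec n) where
  toFun φ := x.1.1.1 (φ + (ρ : Circ), 0) - x.1.1.1 (φ, 1) + x.2.2.1 • dphi v (φ + (ρ : Circ)) 0
  continuous_toFun := by
    have hadd : Continuous fun φ : Circ => φ + (ρ : Circ) := by fun_prop
    have h := (hv.continuous_dphi 0).comp hadd
    have h0 : Continuous fun φ : Circ => ((φ + (ρ : Circ), 0) : Strip) := by fun_prop
    have h1 : Continuous fun φ : Circ => ((φ, 1) : Strip) := by fun_prop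
    exact (((map_continuous x.1.1.1).comp h0).sub ((map_continuous x.1.1.1).comp h1)).add (h.const_smul x.2.2.1)

/-- The third linearized equation: `δ_h = ∫_𝕊 ∫_0^1 ∂_v h δ_v dτ dφ + ∂_p h δ_p`. -/
noncomputable def linPs (K : Fin 2 → C(Strip, Cov n)) (H : Fin 2 → Cov q) (x : Unknowns n q) :
    EuclideanSpace ℝ (Fin 2) :=
  WithLp.toLp 2 fun i =>
    (∫ φ : Circ, ∫ τ : unitInterval, K i (φ, τ) (x.1.1.1 (φ, τ))) + H i x.2.2.2

theorem integral_strip (g : Strip → ℝ) (hg : Continuous g) :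
    ∫ φ : Circ, ∫ τ : unitInterval, g (φ, τ) = ∫ z : Strip, g z := by
  have hi : Integrable g (volume : Measure Strip) :=
    hg.integrable_of_hasCompactSupport (HasCompactSupport.of_compactSpace g)
  exact (integral_prod g hi).symm

theorem linPs_add (K : Fin 2 → C(Strip, Cov n)) (H : Fin 2 → Cov q) (x y : Unknowns n q) :
    linPs K H (x + y) = linPs K H x + linPs K H y := by
  have hc : ∀ (i : Fin 2) (w : C(Strip, Vec n)), Continuous fun z : Strip => K i z (w z) :=
    fun i w => (map_continuous (K i)).clm_apply (map_continuous w)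
  ext i
  have hi : ∀ w : C(Strip, Vec n), Integrable (fun z : Strip => K i z (w z)) :=
    fun w => (hc i w).integrable_of_hasCompactSupport (HasCompactSupport.of_compactSpace _)
  have key : ∀ w : C(Strip, Vec n), ∫ φ : Circ, ∫ τ : unitInterval, K i (φ, τ) (w (φ, τ)) =
      ∫ z : Strip, K i z (w z) := fun w => integral_strip _ (hc i w)
  have e := integral_add (hi x.1.1.1) (hi y.1.1.1)
  have e' : ∫ z : Strip, K i z ((x + y).1.1.1 z) =
      (∫ z : Strip, K i z (x.1.1.1 z)) + ∫ z : Strip, K i z (y.1.1.1 z) := by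
    rw [← e]
    exact integral_congr_ae (Filter.Eventually.of_forall fun z => map_add (K i z) _ _)
  simp only [linPs, PiLp.add_apply, key, e', Prod.snd_add, map_add]
  ring

theorem linPs_smul (K : Fin 2 → C(Strip, Cov n)) (H : Fin 2 → Cov q) (c : ℝ)
    (x : Unknowns n q) : linPs K H (c • x) = c • linPs K H x := by
  ext i
  have e : ∫ φ : Circ, ∫ τ : unitInterval, K i (φ, τ) ((c • x).1.1.1 (φ, τ)) =
      c * ∫ φ : Circ, ∫ τ : unitInterval, K i (φ, τ) (x.1.1.1 (φ, τ)) := by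
    rw [← integral_const_mul]
    refine integral_congr_ae (Filter.Eventually.of_forall fun φ => ?_)
    beta_reduce
    rw [← integral_const_mul]
    exact integral_congr_ae (Filter.Eventually.of_forall fun τ => map_smul (K i (φ, τ)) c _)
  simp only [linPs, PiLp.smul_apply, e, Prod.smul_snd, map_smul, smul_eq_mul]
  ring

/-- The linearization of the zero problem (boundary-value problem and phase conditions) at
`(v, T, ρ, p)`: the map `(δ_v, δ_T, δ_ρ, δ_p) ↦ (δ_ode, δ_bc, δ_h)`. -/
noncomputable def linZero {f : Vec n → Vec q → Vec n} (hf : IsC1Field f) (T ρ : ℝ) (p : Vec q)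
    {v : Circ → ℝ → Vec n} (hv : IsC1 v) (K : Fin 2 → C(Strip, Cov n)) (H : Fin 2 → Cov q) :
    Unknowns n q →ₗ[ℝ] Violations n where
  toFun x := (linOde hf T p hv x, linBc ρ hv x, linPs K H x)
  map_add' x y := by
    refine Prod.ext ?_ (Prod.ext ?_ (linPs_add K H x y))
    · ext1 z
      simp only [linOde, ContinuousMap.coe_mk, Prod.fst_add, Prod.snd_add, Submodule.coe_add,
        ContinuousMap.add_apply, map_add, smul_add, add_smul]
      abel
    · ext1 φ
      simp only [linBc, ContinuousMap.coe_mk, Prod.fst_add, Prod.snd_add, Submodule.coe_add,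
        ContinuousMap.add_apply, add_smul]
      abel
  map_smul' c x := by
    refine Prod.ext ?_ (Prod.ext ?_ (linPs_smul K H c x))
    · ext1 z
      simp only [linOde, ContinuousMap.coe_mk, Prod.smul_fst, Prod.smul_snd, Submodule.coe_smul,
        ContinuousMap.smul_apply, map_smul, smul_sub, RingHom.id_apply, smul_assoc,
        smul_comm T c]
    · ext1 φ
      simp only [linBc, ContinuousMap.coe_mk, Prod.smul_fst, Prod.smul_snd, Submodule.coe_smul,
        ContinuousMap.smul_apply, smul_sub, smul_add, RingHom.id_apply, smul_assoc]

/-- The linearization of the reduced continuation problem, in which `T` and `ρ` are free and the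
monitor function `p` is prescribed: `(δ_v, δ_T, δ_ρ, δ_p) ↦ ((δ_ode, δ_bc, δ_h), δ_p)`. -/
noncomputable def linReduced {f : Vec n → Vec q → Vec n} (hf : IsC1Field f) (T ρ : ℝ) (p : Vec q)
    {v : Circ → ℝ → Vec n} (hv : IsC1 v) (K : Fin 2 → C(Strip, Cov n)) (H : Fin 2 → Cov q) :
    Unknowns n q →ₗ[ℝ] Violations n × Vec q :=
  (linZero hf T ρ p hv K H).prod
    (LinearMap.snd ℝ ℝ (Vec q) ∘ₗ LinearMap.snd ℝ ℝ (ℝ × Vec q) ∘ₗ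
      LinearMap.snd ℝ (StripFun n) (ℝ × ℝ × Vec q))

/-- The adjoint conditions for `(λ_de, λ_bc, λ_ps, η_T, η_ρ, η_p)`, with `λ_bc` continuous;
`λ_de(φ, τ)` matters for `τ ∈ [0,1]` only. -/
structure IsAdjointSolution (f : Vec n → Vec q → Vec n) (T ρ : ℝ) (p : Vec q)
    (v : Circ → ℝ → Vec n) (K : Fin 2 → C(Strip, Cov n)) (H : Fin 2 → Cov q)
    (ldE : Circ → ℝ → Cov n) (lbc : C(Circ, Cov n)) (lps : Fin 2 → ℝ)
    (etaT etaρ : ℝ) (etap : Cov q) : Prop where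
  var_v : ∀ (φ : Circ) (τ : unitInterval), HasDerivWithinAt (ldE φ)
    (-(T • (ldE φ τ).comp (dx f (v φ τ) p)) + ∑ i, lps i • K i (φ, τ)) (Icc 0 1) (τ : ℝ)
  var_v1 : ∀ φ, 0 = ldE φ 1 - lbc φ
  var_v0 : ∀ φ, 0 = -ldE φ 0 + lbc (φ - (ρ : Circ))
  var_T : 0 = -(∫ φ : Circ, ∫ τ in (0 : ℝ)..1, ldE φ τ (f (v φ τ) p)) + etaT
  var_ρ : 0 = (∫ φ : Circ, lbc φ (dphi v (φ + (ρ : Circ)) 0)) + etaρ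
  var_p : 0 = -(∫ φ : Circ, ∫ τ in (0 : ℝ)..1, T • (ldE φ τ).comp (dp f (v φ τ) p)) + etap
    + ∑ i, lps i • H i

/-- The pairing `⟨λ, δΦ⟩ + ⟨η_p, δ_p⟩`. -/
noncomputable def adjointPairing (ldE : Circ → ℝ → Cov n) (lbc : C(Circ, Cov n))
    (lps : Fin 2 → ℝ) (etap : Cov q) (y : Violations n × Vec q) : ℝ :=
  (∫ φ : Circ, ∫ τ : unitInterval, ldE φ τ (y.1.1 (φ, τ))) + (∫ φ : Circ, lbc φ (y.1.2.1 φ))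
    + (∑ i, lps i * y.1.2.2 i) + etap y.2

end QPTorus

/-! Integrating the linearized equation over one turn by variation of constants leaves one equation
on the circle for `u = δ_v(·, 0)`: `u(φ + ρ)` equals `V(φ, 1) u(φ)` plus data, plus multiples of
`∂_τ v` and `∂_φ v` with coefficients `δ_T / T` and `-δ_ρ` (`return_map`). The tangent frame is
transported by `V` (`IsTangent`) and the rows `q_τ`, `q_φ` are transported by `V⁻¹` (`IsCotangent`).
Pairing with a row `r` therefore removes `V` and leaves a scalar cohomological equation `R(φ + ρ) -
R(φ) = data + constant` with `R = r(·, 0) u` (`IsCotangent.return_map`). The transversal part of `u`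
is governed by the bijection `Γ_{ρ,0}`.

All claims about the inverse come from this scalar equation. Its nonzero Fourier modes carry the
small divisors. Its mean has no divisor and yields `δ_T` and `δ_ρ`, which is why these two rows are
bounded. Minimality of the rotation makes homogeneous solutions constant, and the phase conditions
remove the two constants (`linReduced_injective`). Trigonometric polynomials are coboundaries up to
constants, so after a small tangential correction of `δ_bc` every datum is attained
(`linReduced_denseRange`).

For unboundedness, Dirichlet approximation supplies a frequency `k` for which functions of
`cos(2πkφ)` almost do not change under the rotation. Multiplying `∂_τ v` by a polynomial in this
cosine gives tiny data and large `δ_v`. The polynomial has enough free coefficients to satisfy any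
finite number of linear conditions, so appended scalar equations do not help
(`exists_large_unknown`).

For the adjoint problem, pairing `λ_de` with the tangent fields and averaging over the torus forces
`λ_ps = 0`. Then `λ_de` is transported by `V⁻¹`, vanishes on transversal directions
(`IsNormallyHyperbolic.apply_qtr_eq_zero`), and has constant tangential components, which `η_T` and
`η_ρ` fix. -/

namespace QPTorus

open scoped NNReal

/-! ### Linear differential equations and integrals with a parameter -/

section LinearODE

variable {E : Type*} [NormedAddCommGroup E] [NormedSpace ℝ E]

/-- A solution of a homogeneous linear equation that vanishes somewhere vanishes everywhere. -/
theorem eq_zero_of_linear_ode {A : ℝ → E →L[ℝ] E} (hA : Continuous A) {y : ℝ → E}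
    (hy : ∀ t, HasDerivAt y (A t (y t)) t) {t₀ : ℝ} (h0 : y t₀ = 0) (t : ℝ) : y t = 0 := by
  set a := min t t₀ - 1
  set b := max t t₀ + 1
  obtain ⟨C, hC⟩ := (isCompact_Icc (a := a) (b := b)).exists_bound_of_continuousOn hA.continuousOn
  have hlip : ∀ s ∈ Ioo a b, LipschitzOnWith (Real.toNNReal C) (fun x => A s x) univ := by
    intro s hs
    refine ((A s).lipschitz.weaken ?_).lipschitzOnWith
    have := hC s (Ioo_subset_Icc_self hs)
    rw [← NNReal.coe_le_coe, coe_nnnorm]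
    exact this.trans (Real.le_coe_toNNReal C)
  have hmem : ∀ {s}, min t t₀ ≤ s → s ≤ max t t₀ → s ∈ Ioo a b := fun h1 h2 =>
    ⟨by simp only [a]; linarith, by simp only [b]; linarith⟩
  have := ODE_solution_unique_of_mem_Ioo (f := y) (g := fun _ => 0) hlip
    (hmem (min_le_right _ _) (le_max_right _ _)) (fun s _ => ⟨hy s, mem_univ _⟩)
    (fun s _ => ⟨by simpa using hasDerivAt_const s (0 : E), mem_univ _⟩) h0
  exact this (hmem (min_le_left _ _) (le_max_left _ _))

/-- Continuity of `F'` bounds it by a constant on a compact neighbourhood, which serves as the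
dominating function. The purpose is to differentiate the integrated equation for `v` with respect to
the phase. -/
theorem hasDerivAt_intervalIntegral_of_continuous {F F' : ℝ → ℝ → E}
    (hF : Continuous (Function.uncurry F)) (hF' : Continuous (Function.uncurry F'))
    (h : ∀ x t, HasDerivAt (fun x => F x t) (F' x t) x) (a b x₀ : ℝ) :
    HasDerivAt (fun x => ∫ t in a..b, F x t) (∫ t in a..b, F' x₀ t) x₀ := by
  obtain ⟨C, hC⟩ := ((isCompact_closedBall x₀ 1).prod (isCompact_uIcc (a := a) (b := b))
    ).exists_bound_of_continuousOn hF'.continuousOn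
  refine (intervalIntegral.hasDerivAt_integral_of_dominated_loc_of_deriv_le
    (bound := fun _ => C) (Metric.closedBall_mem_nhds x₀ one_pos) ?_ ?_ ?_ ?_ ?_ ?_).2
  · exact Filter.Eventually.of_forall fun x => (hF.uncurry_left x).aestronglyMeasurable
  · exact (hF.uncurry_left x₀).intervalIntegrable _ _
  · exact (hF'.uncurry_left x₀).aestronglyMeasurable
  · exact Filter.Eventually.of_forall fun t ht x hx => hC (x, t) ⟨hx, uIoc_subset_uIcc ht⟩
  · exact intervalIntegrable_const
  · exact Filter.Eventually.of_forall fun t _ x _ => h x t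

variable [CompleteSpace E]

/-- Integrating `w' = g` on `[0,1]`. -/
theorem eq_add_integral_of_hasDerivWithinAt {w g : ℝ → E} (hg : ContinuousOn g (Icc 0 1))
    (hw : ∀ s ∈ Icc (0 : ℝ) 1, HasDerivWithinAt w (g s) (Icc 0 1) s) {t : ℝ}
    (ht : t ∈ Icc (0 : ℝ) 1) : w t = w 0 + ∫ s in (0 : ℝ)..t, g s := by
  have hsub : Icc 0 t ⊆ Icc (0 : ℝ) 1 := Icc_subset_Icc_right ht.2
  rw [intervalIntegral.integral_eq_sub_of_hasDerivAt_of_le ht.1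
    (f := w) (f' := g)
    (fun s hs => ((hw s (hsub hs)).mono hsub).continuousWithinAt)
    (fun s hs => (hw s (hsub (Ioo_subset_Icc_self hs))).hasDerivAt
      (Icc_mem_nhds hs.1 (hs.2.trans_le ht.2)))
    (hg.mono (by rwa [uIcc_of_le ht.1])).intervalIntegrable]
  abel

theorem constant_of_hasDerivWithinAt_zero {w : ℝ → E}
    (hw : ∀ s ∈ Icc (0 : ℝ) 1, HasDerivWithinAt w 0 (Icc 0 1) s) {t : ℝ}
    (ht : t ∈ Icc (0 : ℝ) 1) : w t = w 0 := by
  simpa using eq_add_integral_of_hasDerivWithinAt continuousOn_const hw ht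

end LinearODE

/-! ### Fundamental solutions: invertibility and continuity -/

/-- A family of fundamental solutions, on the circle of initial phases, of a linear differential
equation with continuous coefficients. -/
structure IsFundamental (A V : Circ → ℝ → Vec n →L[ℝ] Vec n) : Prop where
  cont : Continuous fun z : Circ × ℝ => A z.1 z.2
  init : ∀ φ, V φ 0 = ContinuousLinearMap.id ℝ (Vec n)
  ode : ∀ φ τ, HasDerivAt (V φ) ((A φ τ).comp (V φ τ)) τ

namespace IsFundamental

variable {A V : Circ → ℝ → Vec n →L[ℝ] Vec n}

/-- A vector in the kernel of `V φ τ` starts a solution that vanishes at time `τ`, hence also at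
time `0`, where `V` is the identity. In finite dimension injectivity suffices. -/
theorem isInvertible (hV : IsFundamental A V) (φ : Circ) (τ : ℝ) : (V φ τ).IsInvertible := by
  have hinj : Function.Injective (V φ τ) := by
    rw [injective_iff_map_eq_zero]
    intro x hx
    have h := eq_zero_of_linear_ode (A := A φ) (hV.cont.comp (by fun_prop : Continuous fun t : ℝ => (φ, t)))
      (y := fun t => V φ t x) (fun t => (hV.ode φ t).clm_apply (hasDerivAt_const t x) |>.congr_deriv
        (by simp)) hx 0
    simpa [hV.init φ] using h
  exact ⟨(LinearEquiv.ofInjectiveEndo (V φ τ : Vec n →ₗ[ℝ] Vec n) hinj).toContinuousLinearEquiv,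
    by ext; rfl⟩

theorem inverse_apply_self (hV : IsFundamental A V) (φ : Circ) (τ : ℝ) (x : Vec n) :
    (V φ τ).inverse (V φ τ x) = x :=
  DFunLike.congr_fun (hV.isInvertible φ τ).inverse_comp_self x

theorem self_apply_inverse (hV : IsFundamental A V) (φ : Circ) (τ : ℝ) (x : Vec n) :
    V φ τ ((V φ τ).inverse x) = x :=
  DFunLike.congr_fun (hV.isInvertible φ τ).self_comp_inverse x

theorem inverse_zero (hV : IsFundamental A V) (φ : Circ) :
    (V φ 0).inverse = ContinuousLinearMap.id ℝ (Vec n) := by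
  rw [hV.init φ, ContinuousLinearMap.inverse_id]

theorem isUnit (hV : IsFundamental A V) (φ : Circ) (τ : ℝ) : IsUnit (V φ τ) :=
  ⟨⟨V φ τ, (V φ τ).inverse, (hV.isInvertible φ τ).self_comp_inverse,
    (hV.isInvertible φ τ).inverse_comp_self⟩, rfl⟩

theorem hasDerivAt_inverse (hV : IsFundamental A V) (φ : Circ) (τ : ℝ) :
    HasDerivAt (fun t => (V φ t).inverse) (-((V φ τ).inverse.comp (A φ τ))) τ := by
  obtain ⟨u, hu⟩ := hV.isUnit φ τ
  have h1 := hasFDerivAt_ringInverse (𝕜 := ℝ) u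
  have hui : (↑u⁻¹ : Vec n →L[ℝ] Vec n) = (V φ τ).inverse := by
    rw [← hu, ← ContinuousLinearMap.ringInverse_eq_inverse, Ring.inverse_unit]
  rw [hui, hu, ContinuousLinearMap.ringInverse_eq_inverse] at h1
  refine (h1.comp_hasDerivAt τ (hV.ode φ τ)).congr_deriv ?_
  ext1 x
  simp [ContinuousLinearMap.mulLeftRight_apply,
    hV.self_apply_inverse φ τ]

theorem continuous_right (hV : IsFundamental A V) (φ : Circ) : Continuous (V φ) :=
  continuous_iff_continuousAt.2 fun τ => (hV.ode φ τ).continuousAt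

theorem continuous_coeff_right (hV : IsFundamental A V) (φ : Circ) : Continuous (A φ) :=
  hV.cont.comp (by fun_prop : Continuous fun t : ℝ => (φ, t))

/-- The fundamental solutions depend continuously on the phase. -/
theorem continuous (hV : IsFundamental A V) : Continuous fun z : Strip => V z.1 z.2 := by
  -- Joint continuity on the strip amounts to continuity of `φ ↦ V φ` into `C([0,1])`, so the
  -- estimates below are uniform in `τ`.
  let Ac : Circ → C(unitInterval, Vec n →L[ℝ] Vec n) := fun φ =>
    ⟨fun τ => A φ τ, (hV.continuous_coeff_right φ).comp continuous_subtype_val⟩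
  let Vc : Circ → C(unitInterval, Vec n →L[ℝ] Vec n) := fun φ =>
    ⟨fun τ => V φ τ, (hV.continuous_right φ).comp continuous_subtype_val⟩
  have hAc : Continuous Ac := by
    refine ContinuousMap.continuous_of_continuous_uncurry _ ?_
    exact hV.cont.comp (continuous_fst.prodMk (continuous_subtype_val.comp continuous_snd))
  obtain ⟨K, hK⟩ := (isCompact_range hAc).exists_bound_of_continuousOn
    (f := id) continuousOn_id
  have hK' : ∀ φ, ∀ τ : unitInterval, ‖A φ τ‖ ≤ K := fun φ τ =>
    ((Ac φ).norm_coe_le_norm τ).trans (hK _ (mem_range_self φ))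
  have hVc : Continuous Vc := by
    refine continuous_iff_continuousAt.2 fun φ₀ => ?_
    have hb : ∀ φ, dist (Vc φ) (Vc φ₀) ≤
        gronwallBound 0 K (dist (Ac φ) (Ac φ₀) * ‖Vc φ₀‖) 1 := by
      intro φ
      have hmain : ∀ τ ∈ Icc (0 : ℝ) 1, ‖V φ τ - V φ₀ τ‖ ≤
          gronwallBound 0 K (dist (Ac φ) (Ac φ₀) * ‖Vc φ₀‖) (τ - 0) := by
        refine norm_le_gronwallBound_of_norm_deriv_right_le
          (((hV.continuous_right φ).sub (hV.continuous_right φ₀)).continuousOn)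
          (fun τ _ => ((hV.ode φ τ).sub (hV.ode φ₀ τ)).hasDerivWithinAt)
          (by simp [hV.init]) ?_
        intro τ hτ
        have hτ' : τ ∈ Icc (0 : ℝ) 1 := Ico_subset_Icc_self hτ
        -- The difference of two fundamental solutions solves the equation with coefficient `A φ`
        -- and forcing `(A φ - A φ₀) V φ₀`. Grönwall's inequality bounds it by a multiple of the
        -- distance of the coefficients.
        have e : (A φ τ).comp (V φ τ) - (A φ₀ τ).comp (V φ₀ τ) =
            (A φ τ).comp (V φ τ - V φ₀ τ) + (A φ τ - A φ₀ τ).comp (V φ₀ τ) := by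
          ext1 x; simp
        rw [e]
        refine (norm_add_le _ _).trans (add_le_add ?_ ?_)
        · exact (ContinuousLinearMap.opNorm_comp_le _ _).trans
            (mul_le_mul_of_nonneg_right (hK' φ ⟨τ, hτ'⟩) (norm_nonneg _))
        · refine (ContinuousLinearMap.opNorm_comp_le _ _).trans ?_
          have h1 : ‖A φ τ - A φ₀ τ‖ ≤ dist (Ac φ) (Ac φ₀) := by
            rw [← dist_eq_norm]
            exact ContinuousMap.dist_apply_le_dist (f := Ac φ) (g := Ac φ₀) (⟨τ, hτ'⟩ : unitInterval)
          exact mul_le_mul h1 ((Vc φ₀).norm_coe_le_norm ⟨τ, hτ'⟩) (norm_nonneg _) dist_nonneg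
      have hK0 : 0 ≤ K := (norm_nonneg _).trans (hK' φ 0)
      have hε0 : 0 ≤ dist (Ac φ) (Ac φ₀) * ‖Vc φ₀‖ := by positivity
      have hmono := gronwallBound_mono (δ := 0) le_rfl hε0 hK0
      refine (ContinuousMap.dist_le ((norm_nonneg _).trans (hmain 1 (by simp)) |>.trans
        (by simp))).2 fun τ => ?_
      rw [dist_eq_norm]
      exact (hmain τ τ.2).trans (hmono (by simpa using τ.2.2))
    refine (tendsto_iff_dist_tendsto_zero (α := C(unitInterval, Vec n →L[ℝ] Vec n)) (f := Vc)).2 ?_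
    have hcont : Continuous fun φ => gronwallBound 0 K (dist (Ac φ) (Ac φ₀) * ‖Vc φ₀‖) 1 :=
      (gronwallBound_continuous_ε 0 K 1).comp (by fun_prop)
    have hlim := hcont.tendsto φ₀
    simp only [dist_self, zero_mul, gronwallBound_ε0_δ0] at hlim
    exact squeeze_zero (fun _ => dist_nonneg) hb hlim
  exact ContinuousMap.continuous_uncurry_of_continuous ⟨Vc, hVc⟩

theorem continuous_inverse (hV : IsFundamental A V) :
    Continuous fun z : Strip => (V z.1 z.2).inverse := by
  refine continuous_iff_continuousAt.2 fun z => ?_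
  obtain ⟨u, hu⟩ := hV.isUnit z.1 z.2
  have h := NormedRing.inverse_continuousAt u
  rw [hu, ContinuousLinearMap.ringInverse_eq_inverse] at h
  exact ContinuousAt.comp (g := ContinuousLinearMap.inverse) (f := fun z : Strip => V z.1 z.2) h
    hV.continuous.continuousAt

end IsFundamental

/-! ### Transported tangent fields and row fields -/

/-- The coefficient matrix `T ∂_x f(v, p)` of the variational equation. -/
noncomputable def coeff (f : Vec n → Vec q → Vec n) (T : ℝ) (p : Vec q) (v : Circ → ℝ → Vec n)
    (φ : Circ) (τ : ℝ) : Vec n →L[ℝ] Vec n :=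
  T • dx f (v φ τ) p

/-- A vector field along the torus that is carried along by the variational equation. -/
structure IsTangent (ρ : ℝ) (A : Circ → ℝ → Vec n →L[ℝ] Vec n) (e : Circ → ℝ → Vec n) :
    Prop where
  cont : Continuous fun z : Circ × ℝ => e z.1 z.2
  ode : ∀ φ τ, HasDerivAt (e φ) (A φ τ (e φ τ)) τ
  shift : ∀ φ τ, e φ (τ + 1) = e (φ + (ρ : Circ)) τ

/-- A field of row vectors that is carried along by the inverse of the fundamental solution. -/
structure IsCotangent (ρ : ℝ) (V : Circ → ℝ → Vec n →L[ℝ] Vec n) (r : Circ → ℝ → Cov n) :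
    Prop where
  cont : Continuous fun z : Circ × ℝ => r z.1 z.2
  inv : ∀ φ τ x, r φ τ (V φ τ x) = r φ 0 x
  shift : ∀ φ τ, r φ (τ + 1) = r (φ + (ρ : Circ)) τ

section Tangent

variable {f : Vec n → Vec q → Vec n} {T ρ : ℝ} {p : Vec q} {v : Circ → ℝ → Vec n}
  {A V : Circ → ℝ → Vec n →L[ℝ] Vec n} {qτ qφ : Circ → ℝ → Cov n}

theorem continuous_coeff (hf : IsC1Field f) (hv : IsC1 v) :
    Continuous fun z : Circ × ℝ => coeff f T p v z.1 z.2 :=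
  ((hf.continuous_dx p).comp hv.continuous).const_smul T

theorem IsVariationalSolution.isFundamental (hV : IsVariationalSolution f T p v V)
    (hf : IsC1Field f) (hv : IsC1 v) : IsFundamental (coeff f T p v) V :=
  ⟨continuous_coeff hf hv, hV.init, fun φ τ => (hV.ode φ τ).congr_deriv (by ext1 x; rfl)⟩

theorem IsC1Field.hasFDerivAt (hf : IsC1Field f) (x : Vec n) (p : Vec q) :
    HasFDerivAt (fun y => f y p) (dx f x p) x := by
  have h : ContDiff ℝ 1 fun x : Vec n => f x p :=
    ContDiff.comp (g := fun z : Vec n × Vec q => f z.1 z.2) hf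
      (contDiff_id.prodMk contDiff_const)
  exact (h.differentiable (by norm_num) x).hasFDerivAt

theorem IsTorusSolution.dtau_eq (hv : IsTorusSolution f T ρ p v) (φ : Circ) (τ : ℝ) :
    dtau v φ τ = T • f (v φ τ) p :=
  (hv.ode φ τ).deriv

theorem IsTorusSolution.isTangent_dtau (hv : IsTorusSolution f T ρ p v) (hf : IsC1Field f) :
    IsTangent ρ (coeff f T p v) (dtau v) where
  cont := by
    simp only [hv.dtau_eq]
    exact ((hf.continuous p).comp hv.c1.continuous).const_smul T
  ode φ τ := by
    have e : dtau v φ = fun t => T • f (v φ t) p := funext (hv.dtau_eq φ)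
    have h := ((hf.hasFDerivAt (v φ τ) p).comp_hasDerivAt τ (hv.ode φ τ)).const_smul T
    rw [hv.dtau_eq, e]
    exact h
  shift φ τ := by rw [hv.dtau_eq, hv.dtau_eq, hv.bc]

theorem IsC1.dphi_coe (hv : IsC1 v) (x τ : ℝ) : dphi v (x : Circ) τ =
    fderiv ℝ (fun z : ℝ × ℝ => v (z.1 : Circ) z.2) (x, τ) (1, 0) := by
  have hv' : ContDiff ℝ 1 (fun z : ℝ × ℝ => v (z.1 : Circ) z.2) := hv
  have h1 : HasDerivAt (fun s : ℝ => (x + s, τ)) ((1 : ℝ), (0 : ℝ)) 0 :=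
    ((hasDerivAt_id (0 : ℝ)).const_add x).prodMk (hasDerivAt_const _ _)
  have h2 : HasFDerivAt (fun z : ℝ × ℝ => v (z.1 : Circ) z.2)
      (fderiv ℝ (fun z : ℝ × ℝ => v (z.1 : Circ) z.2) (x, τ)) (x + 0, τ) := by
    rw [add_zero]
    exact (hv'.differentiable (by norm_num) _).hasFDerivAt
  simpa [dphi, Function.comp_def] using (h2.comp_hasDerivAt (0 : ℝ) h1).deriv

theorem IsC1.hasDerivAt_dphi (hv : IsC1 v) (x τ : ℝ) :
    HasDerivAt (fun y : ℝ => v (y : Circ) τ) (dphi v (x : Circ) τ) x := by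
  have hv' : ContDiff ℝ 1 (fun z : ℝ × ℝ => v (z.1 : Circ) z.2) := hv
  rw [hv.dphi_coe]
  exact (hv'.differentiable (by norm_num) (x, τ)).hasFDerivAt.comp_hasDerivAt x
    ((hasDerivAt_id x).prodMk (hasDerivAt_const x τ))

theorem continuous_circle_prod {X : Type*} [TopologicalSpace X] {g : Circ × ℝ → X}
    (hg : Continuous fun z : ℝ × ℝ => g ((z.1 : Circ), z.2)) : Continuous g := by
  have hq : IsOpenQuotientMap (Prod.map (fun x : ℝ => (x : Circ)) (id : ℝ → ℝ)) :=
    (QuotientAddGroup.isOpenQuotientMap_mk).prodMap IsOpenQuotientMap.id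
  exact hq.isQuotientMap.continuous_iff.2 hg

theorem IsC1.continuous_dphi_prod (hv : IsC1 v) :
    Continuous fun z : Circ × ℝ => dphi v z.1 z.2 := by
  refine continuous_circle_prod ?_
  simp only [hv.dphi_coe]
  exact (ContDiff.continuous_fderiv hv (by norm_num)).clm_apply continuous_const

/-- Since `v` is only `C¹`, the mixed derivative is not available beforehand. The equation for `v`
is integrated in `τ`, the integral equation is differentiated in the phase, and the result is
differentiated in `τ` by the fundamental theorem of calculus. -/
theorem IsTorusSolution.isTangent_dphi (hv : IsTorusSolution f T ρ p v) (hf : IsC1Field f) :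
    IsTangent ρ (coeff f T p v) (dphi v) where
  cont := hv.c1.continuous_dphi_prod
  ode φ τ := by
    obtain ⟨x, rfl⟩ := QuotientAddGroup.mk_surjective φ
    have hcoe : Continuous fun z : ℝ × ℝ => ((z.1 : Circ), z.2) :=
      ((AddCircle.continuous_mk' 1).comp continuous_fst).prodMk continuous_snd
    have hF : Continuous (Function.uncurry fun x σ : ℝ => T • f (v (x : Circ) σ) p) :=
      (((hf.continuous p).comp hv.c1.continuous).const_smul T).comp hcoe
    have hF' : Continuous (Function.uncurry fun x σ : ℝ =>
        coeff f T p v (x : Circ) σ (dphi v (x : Circ) σ)) :=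
      ((continuous_coeff hf hv.c1).clm_apply hv.c1.continuous_dphi_prod).comp hcoe
    have hint : ∀ t, dphi v (x : Circ) t = dphi v (x : Circ) 0 +
        ∫ σ in (0 : ℝ)..t, coeff f T p v (x : Circ) σ (dphi v (x : Circ) σ) := by
      intro t
      have h1 := (hv.c1.hasDerivAt_dphi x 0).add (hasDerivAt_intervalIntegral_of_continuous hF hF'
        (fun y σ => ((hf.hasFDerivAt (v (y : Circ) σ) p).comp_hasDerivAt y
          (hv.c1.hasDerivAt_dphi y σ)).const_smul T) 0 t x)
      refine (hv.c1.hasDerivAt_dphi x t).unique (h1.congr_of_eventuallyEq ?_)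
      refine Filter.Eventually.of_forall fun y => ?_
      simp only [Pi.add_apply]
      rw [intervalIntegral.integral_eq_sub_of_hasDerivAt (fun σ _ => hv.ode (y : Circ) σ)
        ((hF.uncurry_left y).intervalIntegrable _ _)]
      abel
    have e : dphi v (x : Circ) = fun t => dphi v (x : Circ) 0 +
        ∫ σ in (0 : ℝ)..t, coeff f T p v (x : Circ) σ (dphi v (x : Circ) σ) := funext hint
    rw [e]
    refine HasDerivAt.const_add _ ?_
    have hc := hF'.uncurry_left x
    have := intervalIntegral.integral_hasDerivAt_right (hc.intervalIntegrable 0 τ)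
      (hc.stronglyMeasurableAtFilter _ _) hc.continuousAt
    rw [← e]
    exact this
  shift φ τ := by
    simp only [dphi, hv.bc]
    congr 1
    funext s
    rw [add_right_comm]

theorem IsTangent.map_eq {e : Circ → ℝ → Vec n} (he : IsTangent ρ A e) (hV : IsFundamental A V)
    (φ : Circ) (τ : ℝ) : V φ τ (e φ 0) = e φ τ := by
  have h := eq_zero_of_linear_ode (hV.continuous_coeff_right φ)
    (y := fun t => V φ t (e φ 0) - e φ t) (fun t => ?_) (t₀ := 0) (by simp [hV.init]) τ
  · exact sub_eq_zero.1 h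
  · refine (((hV.ode φ t).clm_apply (hasDerivAt_const t (e φ 0))).sub (he.ode φ t)).congr_deriv ?_
    simp

/-- Invariance means `r(φ, τ) = r(φ, 0) V(φ, τ)⁻¹`, so differentiating the inverse gives the adjoint
equation. -/
theorem IsCotangent.hasDerivAt {r : Circ → ℝ → Cov n} (hr : IsCotangent ρ V r)
    (hV : IsFundamental A V) (φ : Circ) (τ : ℝ) :
    HasDerivAt (r φ) (-((r φ τ).comp (A φ τ))) τ := by
  have e : ∀ t, r φ t = (r φ 0).comp (V φ t).inverse := fun t => by
    ext1 x
    rw [ContinuousLinearMap.comp_apply, ← hr.inv φ t, hV.self_apply_inverse]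
  have h := (hasDerivAt_const τ (r φ 0)).clm_comp (hV.hasDerivAt_inverse φ τ)
  rw [show r φ = fun t => (r φ 0).comp (V φ t).inverse from funext e]
  refine h.congr_deriv ?_
  ext1 x
  simp

theorem dtau_dphi_coeff (hq : IsNormallyHyperbolic ρ v V qτ qφ) {φ : Circ} {τ a b a' b' : ℝ}
    (h : a • dtau v φ τ + b • dphi v φ τ = a' • dtau v φ τ + b' • dphi v φ τ) :
    a = a' ∧ b = b' := by
  have h2 := LinearIndependent.pair_iff.1 (hq.indep φ τ) (a - a') (b - b') (by
    rw [sub_smul, sub_smul, sub_add_sub_comm, h, sub_self])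
  exact ⟨sub_eq_zero.1 h2.1, sub_eq_zero.1 h2.2⟩

theorem qtg_apply (φ : Circ) (τ : ℝ) (x : Vec n) :
    qtg v qτ qφ φ τ x = qτ φ τ x • dtau v φ τ + qφ φ τ x • dphi v φ τ := rfl

theorem IsNormallyHyperbolic.qtg_of_mem (hq : IsNormallyHyperbolic ρ v V qτ qφ) {φ : Circ} {τ : ℝ}
    {x : Vec n} (hx : x ∈ Submodule.span ℝ {dtau v φ τ, dphi v φ τ}) : qtg v qτ qφ φ τ x = x := by
  obtain ⟨y, rfl⟩ : x ∈ Set.range (qtg v qτ qφ φ τ) := by rw [hq.range_eq]; exact hx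
  exact DFunLike.congr_fun (hq.proj φ τ) y

/-- The projection fixes `∂_τ v`; comparing coefficients in the independent frame gives duality of
rows and tangent vectors. -/
theorem IsNormallyHyperbolic.dual_dtau (hq : IsNormallyHyperbolic ρ v V qτ qφ) (φ : Circ) (τ : ℝ) :
    qτ φ τ (dtau v φ τ) = 1 ∧ qφ φ τ (dtau v φ τ) = 0 := by
  refine dtau_dphi_coeff hq (φ := φ) (τ := τ) ?_
  rw [← qtg_apply, hq.qtg_of_mem (Submodule.subset_span (by simp))]
  simp

theorem IsNormallyHyperbolic.dual_dphi (hq : IsNormallyHyperbolic ρ v V qτ qφ) (φ : Circ) (τ : ℝ) :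
    qτ φ τ (dphi v φ τ) = 0 ∧ qφ φ τ (dphi v φ τ) = 1 := by
  refine dtau_dphi_coeff hq (φ := φ) (τ := τ) ?_
  rw [← qtg_apply, hq.qtg_of_mem (Submodule.subset_span (by simp))]
  simp

/-- The invariance and shift conditions concern only the projection `q_tg`. The frame is itself
transported and shifted in the same way, so both conditions can be read off coefficient by
coefficient. -/
theorem IsNormallyHyperbolic.isCotangent (hq : IsNormallyHyperbolic ρ v V qτ qφ)
    (hf : IsC1Field f) (hv : IsTorusSolution f T ρ p v) (hV : IsVariationalSolution f T p v V) :
    IsCotangent ρ V qτ ∧ IsCotangent ρ V qφ := by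
  have hV' := hV.isFundamental hf hv.c1
  have hinv : ∀ φ τ x, qτ φ τ (V φ τ x) = qτ φ 0 x ∧ qφ φ τ (V φ τ x) = qφ φ 0 x := by
    intro φ τ x
    refine dtau_dphi_coeff hq (φ := φ) (τ := τ) ?_
    have h := DFunLike.congr_fun (hq.invariant φ τ) x
    simp only [ContinuousLinearMap.comp_apply, qtg_apply, map_add, map_smul,
      (hv.isTangent_dtau hf).map_eq hV', (hv.isTangent_dphi hf).map_eq hV'] at h
    exact h
  have hshift : ∀ φ τ x, qτ φ (τ + 1) x = qτ (φ + (ρ : Circ)) τ x ∧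
      qφ φ (τ + 1) x = qφ (φ + (ρ : Circ)) τ x := by
    intro φ τ x
    refine dtau_dphi_coeff hq (φ := φ + (ρ : Circ)) (τ := τ) ?_
    have h := DFunLike.congr_fun (hq.shift φ τ) x
    simp only [qtg_apply, (hv.isTangent_dtau hf).shift, (hv.isTangent_dphi hf).shift] at h
    exact h
  exact ⟨⟨hq.cont_qτ, fun φ τ x => (hinv φ τ x).1, fun φ τ => by ext1 x; exact (hshift φ τ x).1⟩,
    ⟨hq.cont_qφ, fun φ τ x => (hinv φ τ x).2, fun φ τ => by ext1 x; exact (hshift φ τ x).2⟩⟩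

theorem IsNormallyHyperbolic.T_ne_zero (hq : IsNormallyHyperbolic ρ v V qτ qφ)
    (hv : IsTorusSolution f T ρ p v) : T ≠ 0 := by
  rintro rfl
  have h := (hq.dual_dtau 0 0).1
  rw [hv.dtau_eq, zero_smul, map_zero] at h
  exact zero_ne_one h

end Tangent

/-! ### Variation of constants and the return map over one turn -/

section Variation

variable {f : Vec n → Vec q → Vec n} {T ρ : ℝ} {p : Vec q} {v : Circ → ℝ → Vec n}
  {A V : Circ → ℝ → Vec n →L[ℝ] Vec n} {qτ qφ : Circ → ℝ → Cov n}

theorem integral_unitInterval {E : Type*} [NormedAddCommGroup E] [NormedSpace ℝ E] (g : ℝ → E) :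
    ∫ σ : unitInterval, g σ = ∫ σ in (0 : ℝ)..1, g σ := by
  rw [intervalIntegral.integral_of_le zero_le_one, ← integral_Icc_eq_integral_Ioc]
  exact integral_subtype measurableSet_Icc g

/-- Variation of constants. -/
theorem IsFundamental.variation_of_constants (hV : IsFundamental A V) (w : StripFun n) (φ : Circ)
    (τ : unitInterval) : w.1.1 (φ, τ) = V φ τ (w.1.1 (φ, 0) + ∫ σ in (0 : ℝ)..τ,
      (V φ σ).inverse (w.1.2 (φ, projIcc 0 1 zero_le_one σ)
        - A φ σ (w.1.1 (φ, projIcc 0 1 zero_le_one σ)))) := by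
  have hproj : Continuous fun σ : ℝ => ((φ, projIcc 0 1 zero_le_one σ) : Strip) :=
    continuous_const.prodMk continuous_projIcc
  have hinv : Continuous fun σ : ℝ => (V φ σ).inverse :=
    continuous_iff_continuousAt.2 fun σ => (hV.hasDerivAt_inverse φ σ).continuousAt
  have hg : Continuous fun σ : ℝ => (V φ σ).inverse (w.1.2 (φ, projIcc 0 1 zero_le_one σ)
        - A φ σ (w.1.1 (φ, projIcc 0 1 zero_le_one σ))) :=
    hinv.clm_apply (((map_continuous w.1.2).comp hproj).sub
      ((hV.continuous_coeff_right φ).clm_apply ((map_continuous w.1.1).comp hproj)))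
  have h := eq_add_integral_of_hasDerivWithinAt
    -- The product `V⁻¹ w` has derivative `V⁻¹ (w' - A w)`.
    (w := fun s => (V φ s).inverse (w.1.1 (φ, projIcc 0 1 zero_le_one s))) hg.continuousOn ?_ τ.2
  · have e0 : projIcc (0 : ℝ) 1 zero_le_one 0 = 0 := projIcc_left _
    simp only [projIcc_val, e0, hV.inverse_zero φ, ContinuousLinearMap.id_apply] at h
    rw [← h, hV.self_apply_inverse]
  · intro s hs
    refine ((hV.hasDerivAt_inverse φ s).hasDerivWithinAt.clm_apply
      (w.2 φ ⟨s, hs⟩)).congr_deriv ?_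
    rw [projIcc_of_mem zero_le_one hs]
    simp only [neg_apply, ContinuousLinearMap.comp_apply, map_sub]
    abel

theorem continuous_strip_right {E : Type*} [TopologicalSpace E] {g : Strip → E} (hg : Continuous g)
    (φ : Circ) : Continuous fun σ : unitInterval => g (φ, σ) :=
  hg.comp (by fun_prop)

theorem integrable_of_continuous {X E : Type*} [TopologicalSpace X] [CompactSpace X]
    [MeasurableSpace X] [OpensMeasurableSpace X] {μ : Measure X} [IsFiniteMeasure μ]
    [NormedAddCommGroup E] [SecondCountableTopology E] {g : X → E} (hg : Continuous g) :
    Integrable g μ := by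
  have : IsFiniteMeasureOnCompacts μ := ⟨fun _ _ => measure_lt_top _ _⟩
  exact hg.integrable_of_hasCompactSupport (HasCompactSupport.of_compactSpace g)

theorem continuous_dp (hf : IsC1Field f) (hv : IsC1 v) :
    Continuous fun z : Circ × ℝ => dp f (v z.1 z.2) p :=
  (hf.continuous_dp p).comp hv.continuous

theorem continuous_strip_of_prod {E : Type*} [TopologicalSpace E] {g : Circ × ℝ → E}
    (hg : Continuous g) : Continuous fun z : Strip => g (z.1, z.2) :=
  hg.comp (continuous_fst.prodMk (continuous_subtype_val.comp continuous_snd))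

theorem PMat_one (φ : Circ) : PMat f T p v V φ 1 =
    T • (V φ 1).comp (∫ σ : unitInterval, (V φ σ).inverse.comp (dp f (v φ σ) p)) := by
  rw [PMat, integral_unitInterval (fun σ => (V φ σ).inverse.comp (dp f (v φ σ) p))]

theorem integral_clm_comp_apply {X E F : Type*} [TopologicalSpace X] [CompactSpace X]
    [MeasurableSpace X] [OpensMeasurableSpace X] {μ : Measure X} [IsFiniteMeasure μ]
    [NormedAddCommGroup E] [NormedSpace ℝ E] [NormedAddCommGroup F] [NormedSpace ℝ F]
    [FiniteDimensional ℝ E] [FiniteDimensional ℝ F]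
    {g : X → E →L[ℝ] F} (hg : Continuous g) (x : E) : (∫ s, g s ∂μ) x = ∫ s, g s x ∂μ := by
  have : CompleteSpace F := FiniteDimensional.complete ℝ F
  exact ContinuousLinearMap.integral_apply (integrable_of_continuous hg) x

/-- One turn of the linearized equations. -/
theorem return_map (hf : IsC1Field f) (hv : IsTorusSolution f T ρ p v)
    (hV : IsVariationalSolution f T p v V) (hT : T ≠ 0) (x : Unknowns n q) (φ : Circ) :
    x.1.1.1 (φ + (ρ : Circ), 0) = V φ 1 (x.1.1.1 (φ, 0))
      + (deltaRhs V (linOde hf T p hv.c1 x) (linBc ρ hv.c1 x) φ + PMat f T p v V φ 1 x.2.2.2)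
      + (x.2.1 / T) • dtau v (φ + (ρ : Circ)) 0 - x.2.2.1 • dphi v (φ + (ρ : Circ)) 0 := by
  have hV' := hV.isFundamental hf hv.c1
  have h1 := hV'.variation_of_constants x.1 φ 1
  have hW := continuous_strip_right hV'.continuous_inverse φ
  have hp := continuous_strip_right (continuous_strip_of_prod (continuous_dp (p := p) hf hv.c1)) φ
  have hcp : Continuous fun σ : unitInterval => (V φ σ).inverse.comp (dp f (v φ σ) p) :=
    hW.clm_comp hp
  have h2 : ∀ σ : unitInterval, (V φ σ).inverse (x.1.1.2 (φ, σ) - coeff f T p v φ σ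
      (x.1.1.1 (φ, σ))) = (V φ σ).inverse (linOde hf T p hv.c1 x (φ, σ))
        + (x.2.1 / T) • dtau v φ 0 + T • (V φ σ).inverse.comp (dp f (v φ σ) p) x.2.2.2 := by
    intro σ
    -- The forcing `f δ_T` equals `(δ_T / T) ∂_τ v`, and `V⁻¹` pulls it back to a vector independent
    -- of `σ`; this is where `T ≠ 0` enters.
    have e1 : x.1.1.2 (φ, σ) - coeff f T p v φ σ (x.1.1.1 (φ, σ)) =
        linOde hf T p hv.c1 x (φ, σ) + (x.2.1 / T) • dtau v φ σ
          + T • dp f (v φ σ) p x.2.2.2 := by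
      rw [hv.dtau_eq, smul_smul, div_mul_cancel₀ _ hT]
      simp only [linOde, ContinuousMap.coe_mk, coeff, smul_apply]
      abel
    rw [e1, map_add, map_add, map_smul, map_smul,
      ← (hv.isTangent_dtau hf).map_eq hV' φ σ, hV'.inverse_apply_self]
    rfl
  have h3 : ∫ σ in (0 : ℝ)..1, (V φ σ).inverse (x.1.1.2 (φ, projIcc 0 1 zero_le_one σ)
        - coeff f T p v φ σ (x.1.1.1 (φ, projIcc 0 1 zero_le_one σ))) =
      (∫ σ : unitInterval, (V φ σ).inverse (linOde hf T p hv.c1 x (φ, σ)))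
        + (x.2.1 / T) • dtau v φ 0
        + T • (∫ σ : unitInterval, (V φ σ).inverse.comp (dp f (v φ σ) p)) x.2.2.2 := by
    rw [← integral_unitInterval]
    simp only [projIcc_val]
    simp only [h2]
    have i1 : Continuous fun σ : unitInterval => (V φ σ).inverse (linOde hf T p hv.c1 x (φ, σ)) :=
      hW.clm_apply (continuous_strip_right (map_continuous _) φ)
    have i2 : Continuous fun σ : unitInterval =>
        T • (V φ σ).inverse.comp (dp f (v φ σ) p) x.2.2.2 :=
      (hcp.clm_apply continuous_const).const_smul T
    have i3 : Continuous fun σ : unitInterval =>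
        (V φ σ).inverse (linOde hf T p hv.c1 x (φ, σ)) + (x.2.1 / T) • dtau v φ 0 :=
      i1.add continuous_const
    rw [integral_add (integrable_of_continuous i3) (integrable_of_continuous i2),
      integral_add (integrable_of_continuous i1) (integrable_of_continuous continuous_const),
      integral_smul, integral_const, integral_clm_comp_apply hcp]
    simp [integral_smul]
  have h4 : x.1.1.1 (φ + (ρ : Circ), 0) = linBc ρ hv.c1 x φ + x.1.1.1 (φ, 1)
      - x.2.2.1 • dphi v (φ + (ρ : Circ)) 0 := by
    simp only [linBc, ContinuousMap.coe_mk]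
    abel
  have h5 : dtau v (φ + (ρ : Circ)) 0 = V φ 1 (dtau v φ 0) := by
    rw [(hv.isTangent_dtau hf).map_eq hV', ← (hv.isTangent_dtau hf).shift, zero_add]
  rw [Icc.coe_one, h3] at h1
  rw [h4, h1, h5, PMat_one, deltaRhs]
  simp only [map_add, map_smul, smul_apply, ContinuousLinearMap.comp_apply]
  abel

/-- Applying `r(φ, 1)` cancels `V(φ, 1)` by invariance, while the shift rule rewrites it as `r(φ +
ρ, 0)`. What remains is a difference of one scalar function along the rotation. -/
theorem IsCotangent.return_map {r : Circ → ℝ → Cov n} (hr : IsCotangent ρ V r) (hf : IsC1Field f)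
    (hv : IsTorusSolution f T ρ p v) (hV : IsVariationalSolution f T p v V) (hT : T ≠ 0)
    (x : Unknowns n q) (φ : Circ) :
    r φ 1 (deltaRhs V (linOde hf T p hv.c1 x) (linBc ρ hv.c1 x) φ + PMat f T p v V φ 1 x.2.2.2) =
      r (φ + (ρ : Circ)) 0 (x.1.1.1 (φ + (ρ : Circ), 0)) - r φ 0 (x.1.1.1 (φ, 0))
      - (x.2.1 / T) * r (φ + (ρ : Circ)) 0 (dtau v (φ + (ρ : Circ)) 0)
      + x.2.2.1 * r (φ + (ρ : Circ)) 0 (dphi v (φ + (ρ : Circ)) 0) := by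
  have h := congr_arg (r φ 1) (QPTorus.return_map hf hv hV hT x φ)
  have hs : r (φ + (ρ : Circ)) 0 = r φ 1 := by rw [← hr.shift, zero_add]
  rw [map_sub, map_add, map_add, hr.inv, map_smul, map_smul, smul_eq_mul, smul_eq_mul] at h
  rw [hs, h]
  ring

end Variation

/-! ### Small divisors and irrational rotations -/

section SmallDivisors

theorem small_divisor_ne_zero {ρ : ℝ} (hρ : Irrational ρ) {k : ℤ} (hk : k ≠ 0) :
    (1 : ℂ) - Complex.exp (-(2 * Real.pi * Complex.I * k * ρ)) ≠ 0 := by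
  intro h
  obtain ⟨m, hm⟩ := Complex.exp_eq_one_iff.1 (sub_eq_zero.1 h).symm
  have h1 : ((k : ℂ) * ρ + m) * (2 * Real.pi * Complex.I) = 0 := by linear_combination -hm
  have h2 : (k : ℂ) * ρ + m = 0 := (mul_eq_zero.1 h1).resolve_right Complex.two_pi_I_ne_zero
  have h3 : (k : ℝ) * ρ + m = 0 := by exact_mod_cast h2
  exact ((hρ.intCast_mul hk).add_intCast m).ne_zero h3

/-- Dirichlet's theorem gives `0 < k ≤ N` with `kρ` within `1 / (N + 1)` of an integer, and the
divisor is at most `2π` times this distance. -/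
theorem exists_small_divisor (ρ : ℝ) {ε : ℝ} (hε : 0 < ε) : ∃ k : ℤ, k ≠ 0 ∧
    ‖(1 : ℂ) - Complex.exp (-(2 * Real.pi * Complex.I * k * ρ))‖ < ε := by
  obtain ⟨N, hN⟩ := exists_nat_gt (2 * Real.pi / ε)
  have hN0 : 0 < N := by
    have : (0 : ℝ) < N := lt_trans (by positivity) hN
    exact_mod_cast this
  obtain ⟨k, hk0, -, hk⟩ := Real.exists_nat_abs_mul_sub_round_le ρ hN0
  refine ⟨k, by exact_mod_cast hk0.ne', ?_⟩
  set m := round (k * ρ)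
  have e : Complex.exp (-(2 * Real.pi * Complex.I * (k : ℤ) * ρ)) =
      Complex.exp (Complex.I * ((-(2 * Real.pi * (k * ρ - m)) : ℝ) : ℂ)) := by
    rw [Complex.exp_eq_exp_iff_exists_int]
    exact ⟨-m, by push_cast; ring⟩
  rw [e, norm_sub_rev]
  refine Real.norm_exp_I_mul_ofReal_sub_one_le.trans_lt ?_
  rw [Real.norm_eq_abs, abs_neg, abs_mul, abs_of_pos (by positivity : 0 < 2 * Real.pi)]
  have h2 : 2 * Real.pi * |k * ρ - m| ≤ 2 * Real.pi * (1 / (N + 1)) := by gcongr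
  refine h2.trans_lt ?_
  rw [div_lt_iff₀ hε] at hN
  rw [mul_one_div, div_lt_iff₀ (by positivity)]
  linarith

theorem fourierCoeff_translate (R : Circ → ℂ) (ρ : ℝ) (k : ℤ) :
    fourierCoeff (fun φ => R (φ - (ρ : Circ))) k =
      Complex.exp (-(2 * Real.pi * Complex.I * k * ρ)) * fourierCoeff R k := by
  have hf : ∀ t : Circ, fourier (-k) t =
      Complex.exp (-(2 * Real.pi * Complex.I * k * ρ)) * fourier (-k) (t - (ρ : Circ)) := by
    intro t
    obtain ⟨s, rfl⟩ := QuotientAddGroup.mk_surjective t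
    rw [show (QuotientAddGroup.mk s : Circ) - (ρ : Circ) = ((s - ρ : ℝ) : Circ) from rfl]
    rw [fourier_coe_apply, fourier_coe_apply, ← Complex.exp_add]
    congr 1
    push_cast
    ring
  simp only [fourierCoeff]
  rw [← integral_const_mul, ← integral_sub_right_eq_self (fun t : Circ =>
    Complex.exp (-(2 * Real.pi * Complex.I * k * ρ)) * fourier (-k) t • R t) (ρ : Circ)]
  congr 1
  funext t
  rw [hf t, smul_eq_mul, smul_eq_mul, mul_assoc]

theorem fourierCoeff_const {k : ℤ} (hk : k ≠ 0) (c : ℂ) : fourierCoeff (fun _ : Circ => c) k = 0 := by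
  have h := fourierCoeff.const_mul (T := (1 : ℝ)) (fun x => fourier 0 x) c k
  rw [fourierCoeff_fourier] at h
  simpa [hk] using h

/-- Translation by `ρ` acts on the `k`-th mode as a scalar, and the constant `c` is invisible for `k
≠ 0`. -/
theorem fourierCoeff_sub_translate {R : Circ → ℂ} (hR : Continuous R) (c : ℂ) (ρ : ℝ) {k : ℤ}
    (hk : k ≠ 0) : fourierCoeff (fun φ => R φ - R (φ - (ρ : Circ)) + c) k =
      ((1 : ℂ) - Complex.exp (-(2 * Real.pi * Complex.I * k * ρ))) * fourierCoeff R k := by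
  have hR' : Continuous fun φ => R (φ - (ρ : Circ)) := by fun_prop
  have e : (fun φ => R φ - R (φ - (ρ : Circ)) + c) =
      (R + (fun φ => (-1 : ℂ) * R (φ - (ρ : Circ)))) + fun _ => c := by
    funext φ
    simp [sub_eq_add_neg]
  have hR'' : Continuous fun φ => (-1 : ℂ) * R (φ - (ρ : Circ)) := continuous_const.mul hR'
  have h1 : Continuous (R + fun φ => (-1 : ℂ) * R (φ - (ρ : Circ))) := hR.add hR''
  rw [e, fourierCoeff.add (integrable_of_continuous h1)
    (integrable_of_continuous continuous_const),
    fourierCoeff.add (integrable_of_continuous hR)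
    (integrable_of_continuous hR''), Pi.add_apply, Pi.add_apply, fourierCoeff.const_mul,
    fourierCoeff_translate, fourierCoeff_const hk]
  ring

/-- Irrational rotations are minimal. -/
theorem constant_of_rotation_invariant {ρ : ℝ} (hρ : Irrational ρ) {a : Circ → ℝ}
    (ha : Continuous a) (h : ∀ φ, a (φ + (ρ : Circ)) = a φ) (φ : Circ) : a φ = a 0 := by
  have hd : DenseRange (fun m : ℤ => m • (ρ : Circ)) :=
    AddCircle.denseRange_zsmul_coe_iff.2 (by simpa using hρ)
  have hper : Function.Periodic a (ρ : Circ) := h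
  -- The function agrees with `a 0` on the orbit of `0`, which is dense.
  refine congr_fun (hd.equalizer ha continuous_const (funext fun m => ?_)) φ
  have := hper.zsmul m 0
  simpa using this

end SmallDivisors

/-! ### Mean equations and equations for the Fourier modes -/

section Means

variable {f : Vec n → Vec q → Vec n} {T ρ : ℝ} {p : Vec q} {v : Circ → ℝ → Vec n}
  {A V : Circ → ℝ → Vec n →L[ℝ] Vec n} {qτ qφ : Circ → ℝ → Cov n} {r : Circ → ℝ → Cov n}

theorem integral_circle_const {E : Type*} [NormedAddCommGroup E] [NormedSpace ℝ E]
    [CompleteSpace E] (c : E) : ∫ _ : Circ, c = c := by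
  simp [Measure.real]

theorem IsTangent.shift_one {e : Circ → ℝ → Vec n} (he : IsTangent ρ A e) (φ : Circ) :
    e φ 1 = e (φ + (ρ : Circ)) 0 := by
  simpa using he.shift φ 0

theorem IsCotangent.shift_one (hr : IsCotangent ρ V r) (φ : Circ) :
    r φ 1 = r (φ + (ρ : Circ)) 0 := by
  simpa using hr.shift φ 0

theorem continuous_integral_unitInterval {E : Type*} [NormedAddCommGroup E] [NormedSpace ℝ E]
    {g : Strip → E} (hg : Continuous g) :
    Continuous fun φ : Circ => ∫ σ : unitInterval, g (φ, σ) := by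
  have h := continuous_parametric_integral_of_continuous (μ := (volume : Measure unitInterval))
    (f := fun φ σ => g (φ, σ)) hg isCompact_univ
  simpa using h

theorem continuous_circle_of_prod {X : Type*} [TopologicalSpace X] {g : Circ × ℝ → X}
    (hg : Continuous g) (τ : ℝ) : Continuous fun φ : Circ => g (φ, τ) :=
  hg.comp (by fun_prop)

theorem IsFundamental.continuous_one (hV : IsFundamental A V) : Continuous fun φ => V φ 1 := by
  have h := hV.continuous.comp (by fun_prop : Continuous fun φ : Circ => ((φ, 1) : Strip))
  simpa [Function.comp_def] using h

theorem continuous_deltaRhs (hV : IsFundamental A V) (δode : C(Strip, Vec n))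
    (δbc : C(Circ, Vec n)) : Continuous (deltaRhs V δode δbc) :=
  (map_continuous δbc).add (hV.continuous_one.clm_apply
    (continuous_integral_unitInterval (hV.continuous_inverse.clm_apply (map_continuous δode))))

theorem continuous_PMat (hf : IsC1Field f) (hv : IsC1 v) (hV : IsFundamental A V) :
    Continuous fun φ => PMat f T p v V φ 1 := by
  simp only [PMat_one]
  exact (hV.continuous_one.clm_comp (continuous_integral_unitInterval
    (hV.continuous_inverse.clm_comp (continuous_strip_of_prod (continuous_dp hf hv))))).const_smul T

/-- The difference along the rotation integrates to zero because Haar measure is invariant. Only the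
constants, and hence `δ_T` and `δ_ρ`, survive. -/
theorem IsCotangent.mean (hr : IsCotangent ρ V r) (hf : IsC1Field f)
    (hv : IsTorusSolution f T ρ p v) (hV : IsVariationalSolution f T p v V) (hT : T ≠ 0) {a b : ℝ}
    (ha : ∀ φ, r φ 0 (dtau v φ 0) = a) (hb : ∀ φ, r φ 0 (dphi v φ 0) = b) (x : Unknowns n q) :
    (∫ φ : Circ, r φ 1 (deltaRhs V (linOde hf T p hv.c1 x) (linBc ρ hv.c1 x) φ))
      + (∫ φ : Circ, (r φ 1).comp (PMat f T p v V φ 1)) x.2.2.2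
      = -(x.2.1 / T) * a + x.2.2.1 * b := by
  have hV' := hV.isFundamental hf hv.c1
  have hr1 : Continuous fun φ : Circ => r φ 1 := continuous_circle_of_prod hr.cont 1
  have hr0 : Continuous fun φ : Circ => r φ 0 := continuous_circle_of_prod hr.cont 0
  have hP := continuous_PMat (T := T) (p := p) hf hv.c1 hV'
  have c1 := hr1.clm_apply (continuous_deltaRhs hV' (linOde hf T p hv.c1 x) (linBc ρ hv.c1 x))
  have c2 : Continuous fun φ => (r φ 1).comp (PMat f T p v V φ 1) x.2.2.2 :=
    (hr1.clm_comp hP).clm_apply continuous_const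
  have hx0 : Continuous fun φ : Circ => x.1.1.1 (φ, 0) :=
    (map_continuous x.1.1.1).comp (by fun_prop)
  have hR : Continuous fun φ : Circ => r φ 0 (x.1.1.1 (φ, 0)) := hr0.clm_apply hx0
  have hRs : Continuous fun φ : Circ => r (φ + (ρ : Circ)) 0 (x.1.1.1 (φ + (ρ : Circ), 0)) :=
    hR.comp (by fun_prop : Continuous fun φ : Circ => φ + (ρ : Circ))
  rw [integral_clm_comp_apply (hr1.clm_comp hP), ← integral_add (integrable_of_continuous c1)
    (integrable_of_continuous c2)]
  have h : ∀ φ : Circ, r φ 1 (deltaRhs V (linOde hf T p hv.c1 x) (linBc ρ hv.c1 x) φ)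
      + (r φ 1).comp (PMat f T p v V φ 1) x.2.2.2 =
      (r (φ + (ρ : Circ)) 0 (x.1.1.1 (φ + (ρ : Circ), 0)) - r φ 0 (x.1.1.1 (φ, 0)))
      + (-(x.2.1 / T) * a + x.2.2.1 * b) := by
    intro φ
    have h := hr.return_map hf hv hV hT x φ
    rw [ha, hb, map_add] at h
    rw [ContinuousLinearMap.comp_apply, h]
    ring
  have hd : Continuous fun φ : Circ => r (φ + (ρ : Circ)) 0 (x.1.1.1 (φ + (ρ : Circ), 0))
      - r φ 0 (x.1.1.1 (φ, 0)) := hRs.sub hR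
  simp only [h]
  rw [integral_add (integrable_of_continuous hd) (integrable_of_continuous
    continuous_const), integral_sub (integrable_of_continuous hRs) (integrable_of_continuous hR),
    integral_add_right_eq_self (fun φ : Circ => r φ 0 (x.1.1.1 (φ, 0))) (ρ : Circ), integral_circle_const, sub_self, zero_add]

theorem IsCotangent.mean_translate (hr : IsCotangent ρ V r) (hf : IsC1Field f)
    (hv : IsTorusSolution f T ρ p v) (hV : IsVariationalSolution f T p v V) (hT : T ≠ 0) {a b : ℝ}
    (ha : ∀ φ, r φ 0 (dtau v φ 0) = a) (hb : ∀ φ, r φ 0 (dphi v φ 0) = b) (x : Unknowns n q) :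
    (∫ φ : Circ, r (φ - (ρ : Circ)) 1
        (deltaRhs V (linOde hf T p hv.c1 x) (linBc ρ hv.c1 x) (φ - (ρ : Circ))))
      + (∫ φ : Circ, (r (φ - (ρ : Circ)) 1).comp (PMat f T p v V (φ - (ρ : Circ)) 1)) x.2.2.2
      = -(x.2.1 / T) * a + x.2.2.1 * b := by
  rw [← hr.mean hf hv hV hT ha hb x, integral_sub_right_eq_self (fun φ : Circ => r φ 1
    (deltaRhs V (linOde hf T p hv.c1 x) (linBc ρ hv.c1 x) φ)) (ρ : Circ),
    integral_sub_right_eq_self (fun φ : Circ => (r φ 1).comp (PMat f T p v V φ 1)) (ρ : Circ)]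

/-- The terms in `δ_T` and `δ_ρ` are constant in the phase, so they do not appear in any mode with
`k ≠ 0`. -/
theorem IsCotangent.fourierCoeff_eq (hr : IsCotangent ρ V r) (hf : IsC1Field f)
    (hv : IsTorusSolution f T ρ p v) (hV : IsVariationalSolution f T p v V) (hT : T ≠ 0) {a b : ℝ}
    (ha : ∀ φ, r φ 0 (dtau v φ 0) = a) (hb : ∀ φ, r φ 0 (dphi v φ 0) = b) (x : Unknowns n q)
    {k : ℤ} (hk : k ≠ 0) :
    ((1 : ℂ) - Complex.exp (-(2 * Real.pi * Complex.I * k * ρ))) *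
        fourierCoeff (fun φ : Circ => ((r φ 0 (x.1.1.1 (φ, 0)) : ℝ) : ℂ)) k =
      fourierCoeff (fun φ : Circ => ((r φ 0
        (deltaRhs V (linOde hf T p hv.c1 x) (linBc ρ hv.c1 x) (φ - (ρ : Circ))
          + PMat f T p v V (φ - (ρ : Circ)) 1 x.2.2.2) : ℝ) : ℂ)) k := by
  have hr0 : Continuous fun φ : Circ => r φ 0 := continuous_circle_of_prod hr.cont 0
  have hx0 : Continuous fun φ : Circ => x.1.1.1 (φ, 0) :=
    (map_continuous x.1.1.1).comp (by fun_prop)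
  have hR : Continuous fun φ : Circ => ((r φ 0 (x.1.1.1 (φ, 0)) : ℝ) : ℂ) :=
    Complex.continuous_ofReal.comp (hr0.clm_apply hx0)
  rw [← fourierCoeff_sub_translate hR (((-(x.2.1 / T) * a + x.2.2.1 * b : ℝ)) : ℂ) ρ hk]
  congr 1
  funext φ
  have h := hr.return_map hf hv hV hT x (φ - (ρ : Circ))
  have hs : r (φ - (ρ : Circ)) 1 = r φ 0 := by
    rw [hr.shift_one, sub_add_cancel]
  rw [hs] at h
  simp only [sub_add_cancel] at h
  rw [h, ha, hb]
  push_cast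
  ring

end Means

/-! ### Transversal directions and injectivity -/

section Transversal

variable {f : Vec n → Vec q → Vec n} {T ρ : ℝ} {p : Vec q} {v : Circ → ℝ → Vec n}
  {V : Circ → ℝ → Vec n →L[ℝ] Vec n} {qτ qφ : Circ → ℝ → Cov n}

theorem qtr_apply (φ : Circ) (τ : ℝ) (x : Vec n) : qtr v qτ qφ φ τ x =
    x - (qτ φ τ x • dtau v φ τ + qφ φ τ x • dphi v φ τ) := rfl

theorem IsNormallyHyperbolic.cotangent_qtr (hq : IsNormallyHyperbolic ρ v V qτ qφ) (φ : Circ)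
    (τ : ℝ) (x : Vec n) :
    qτ φ τ (qtr v qτ qφ φ τ x) = 0 ∧ qφ φ τ (qtr v qτ qφ φ τ x) = 0 := by
  simp [qtr_apply, hq.dual_dtau φ τ, hq.dual_dphi φ τ]

theorem IsNormallyHyperbolic.qtr_qtr (hq : IsNormallyHyperbolic ρ v V qτ qφ) (φ : Circ)
    (τ : ℝ) (x : Vec n) : qtr v qτ qφ φ τ (qtr v qτ qφ φ τ x) = qtr v qτ qφ φ τ x := by
  rw [qtr_apply, (hq.cotangent_qtr φ τ x).1, (hq.cotangent_qtr φ τ x).2]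
  simp

theorem IsNormallyHyperbolic.map_qtr (hq : IsNormallyHyperbolic ρ v V qτ qφ) (φ : Circ)
    (x : Vec n) : V φ 1 (qtr v qτ qφ φ 0 x) = qtr v qτ qφ (φ + (ρ : Circ)) 0 (V φ 1 x) := by
  have h1 := DFunLike.congr_fun (hq.invariant φ 1) x
  have h2 := hq.shift φ 0
  rw [zero_add] at h2
  rw [h2] at h1
  simp only [ContinuousLinearMap.comp_apply] at h1
  simp only [qtr, sub_apply, ContinuousLinearMap.id_apply, map_sub, h1]

theorem IsNormallyHyperbolic.continuous_qtr (hq : IsNormallyHyperbolic ρ v V qτ qφ)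
    (hf : IsC1Field f) (hv : IsTorusSolution f T ρ p v) :
    Continuous fun z : Circ × ℝ => qtr v qτ qφ z.1 z.2 := by
  have h1 := ((ContinuousLinearMap.smulRightL ℝ (Vec n) (Vec n)).continuous.comp
    hq.cont_qτ).clm_apply (hv.isTangent_dtau hf).cont
  have h2 := ((ContinuousLinearMap.smulRightL ℝ (Vec n) (Vec n)).continuous.comp
    hq.cont_qφ).clm_apply (hv.isTangent_dphi hf).cont
  exact continuous_const.sub (h1.add h2)

theorem IsVariationalSolution.Gam_zero (hV : IsVariationalSolution f T p v V) (w : Circ → Vec n)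
    (φ : Circ) : Gam ρ V 0 w φ = V (φ - (ρ : Circ)) 1 (w (φ - (ρ : Circ))) - w φ := by
  simp [Gam, hV.init]

theorem IsNormallyHyperbolic.isTransversal (_ : IsNormallyHyperbolic ρ v V qτ qφ)
    {w : C(Circ, Vec n)} (hw : ∀ φ, qtr v qτ qφ φ 0 (w φ) = w φ) : IsTransversal v qτ qφ 0 w :=
  ⟨w, fun φ => (hw φ).symm⟩

/-- The uniqueness half of the bijectivity of `Γ_{ρ,0}`: both `w` and `0` are transversal with image
`0`. -/
theorem IsNormallyHyperbolic.eq_zero_of_map_eq (hq : IsNormallyHyperbolic ρ v V qτ qφ)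
    (hV : IsVariationalSolution f T p v V) {w : C(Circ, Vec n)}
    (hw : ∀ φ, qtr v qτ qφ φ 0 (w φ) = w φ)
    (h : ∀ φ, w (φ + (ρ : Circ)) = V φ 1 (w φ)) : w = 0 := by
  obtain ⟨C, hC⟩ := hq.bijective 0
  obtain ⟨w₀, -, -, -, hu⟩ := hC 0 (hq.isTransversal (by simp))
  have h0 := hu 0 (hq.isTransversal (by simp)) (by simp [hV.Gam_zero])
  have h1 := hu w (hq.isTransversal hw) (fun φ => by
    rw [hV.Gam_zero, ← h, sub_add_cancel, sub_self]; rfl)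
  rw [h1, h0]

/-- The existence half, evaluated at `φ + ρ` so that no backward shift remains. -/
theorem IsNormallyHyperbolic.exists_map_sub_eq (hq : IsNormallyHyperbolic ρ v V qτ qφ)
    (hV : IsVariationalSolution f T p v V) {g : C(Circ, Vec n)}
    (hg : ∀ φ, qtr v qτ qφ φ 0 (g φ) = g φ) :
    ∃ w : C(Circ, Vec n), (∀ φ, qtr v qτ qφ φ 0 (w φ) = w φ) ∧
      ∀ φ, V φ 1 (w φ) - w (φ + (ρ : Circ)) = g (φ + (ρ : Circ)) := by
  obtain ⟨C, hC⟩ := hq.bijective 0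
  obtain ⟨w, ⟨δ, hδ⟩, hw, -, -⟩ := hC g (hq.isTransversal hg)
  refine ⟨w, fun φ => by rw [hδ, hq.qtr_qtr], fun φ => ?_⟩
  have := hw (φ + (ρ : Circ))
  rwa [hV.Gam_zero, add_sub_cancel_right] at this

theorem integral_tangent_combination (K : C(Strip, Cov n)) {e₁ e₂ : Circ → ℝ → Vec n}
    (h₁ : Continuous fun z : Circ × ℝ => e₁ z.1 z.2)
    (h₂ : Continuous fun z : Circ × ℝ => e₂ z.1 z.2) (a b : ℝ) :
    ∫ φ : Circ, ∫ τ : unitInterval, K (φ, τ) (a • e₁ φ τ + b • e₂ φ τ) =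
      a * (∫ φ : Circ, ∫ τ : unitInterval, K (φ, τ) (e₁ φ τ))
        + b * ∫ φ : Circ, ∫ τ : unitInterval, K (φ, τ) (e₂ φ τ) := by
  have c1 : Continuous fun z : Strip => K z (e₁ z.1 z.2) :=
    (map_continuous K).clm_apply (continuous_strip_of_prod h₁)
  have c2 : Continuous fun z : Strip => K z (e₂ z.1 z.2) :=
    (map_continuous K).clm_apply (continuous_strip_of_prod h₂)
  have c3 : Continuous fun z : Strip => K z (a • e₁ z.1 z.2 + b • e₂ z.1 z.2) :=
    (map_continuous K).clm_apply (((continuous_strip_of_prod h₁).const_smul a).add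
      ((continuous_strip_of_prod h₂).const_smul b))
  rw [integral_strip (fun z => K z (a • e₁ z.1 z.2 + b • e₂ z.1 z.2)) c3,
    integral_strip (fun z => K z (e₁ z.1 z.2)) c1, integral_strip (fun z => K z (e₂ z.1 z.2)) c2,
    ← integral_const_mul, ← integral_const_mul, ← integral_add
    ((integrable_of_continuous c1).const_mul a) ((integrable_of_continuous c2).const_mul b)]
  congr 1
  funext z
  simp

/-- The non-degeneracy matrix of the phase conditions. -/
noncomputable def phaseMatrix (v : Circ → ℝ → Vec n) (K : Fin 2 → C(Strip, Cov n)) :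
    Matrix (Fin 2) (Fin 2) ℝ :=
  Matrix.of fun i : Fin 2 => ![∫ φ : Circ, ∫ τ : unitInterval, K i (φ, τ) (dtau v φ τ),
      ∫ φ : Circ, ∫ τ : unitInterval, K i (φ, τ) (dphi v φ τ)]

theorem integral_tangent_eq_mulVec (hf : IsC1Field f) (hv : IsTorusSolution f T ρ p v)
    (K : Fin 2 → C(Strip, Cov n)) (c : Fin 2 → ℝ) (i : Fin 2) :
    ∫ φ : Circ, ∫ τ : unitInterval, K i (φ, τ) (c 0 • dtau v φ τ + c 1 • dphi v φ τ) =
      (phaseMatrix v K).mulVec c i := by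
  rw [integral_tangent_combination (K i) (hv.isTangent_dtau hf).cont (hv.isTangent_dphi hf).cont]
  simp [phaseMatrix, Matrix.mulVec, dotProduct, Fin.sum_univ_two, mul_comm]

theorem deltaRhs_zero (φ : Circ) : deltaRhs V 0 0 φ = 0 := by
  simp [deltaRhs]

/-- For zero data the means give `δ_T = δ_ρ = 0`. The tangential components of `δ_v(·, 0)` are then
invariant under an irrational rotation and hence constant, and the transversal component vanishes.
So `δ_v` is a constant combination of the two tangent fields, and the nonsingular phase matrix kills
its coefficients. -/
theorem linReduced_injective (hρ : Irrational ρ) (hf : IsC1Field f)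
    (hv : IsTorusSolution f T ρ p v) (hV : IsVariationalSolution f T p v V)
    (hq : IsNormallyHyperbolic ρ v V qτ qφ) (K : Fin 2 → C(Strip, Cov n)) (H : Fin 2 → Cov q)
    (hK : (phaseMatrix v K).det ≠ 0) :
    Function.Injective (linReduced hf T ρ p hv.c1 K H) := by
  rw [injective_iff_map_eq_zero]
  intro x hx
  have hV' := hV.isFundamental hf hv.c1
  have hT := hq.T_ne_zero hv
  obtain ⟨hrτ, hrφ⟩ := hq.isCotangent hf hv hV
  have hode : linOde hf T p hv.c1 x = 0 := congr_arg (fun y => y.1.1) hx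
  have hbc : linBc ρ hv.c1 x = 0 := congr_arg (fun y => y.1.2.1) hx
  have hps : linPs K H x = 0 := congr_arg (fun y => y.1.2.2) hx
  have hp : x.2.2.2 = 0 := congr_arg (fun y => y.2) hx
  have hδT : x.2.1 = 0 := by
    have h := hrτ.mean hf hv hV hT (fun φ => (hq.dual_dtau φ 0).1) (fun φ => (hq.dual_dphi φ 0).1) x
    simpa [hode, hbc, hp, deltaRhs_zero, hT] using h
  have hδρ : x.2.2.1 = 0 := by
    have h := hrφ.mean hf hv hV hT (fun φ => (hq.dual_dtau φ 0).2) (fun φ => (hq.dual_dphi φ 0).2) x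
    simpa [hode, hbc, hp, deltaRhs_zero] using h.symm
  have hret : ∀ φ : Circ, x.1.1.1 (φ + (ρ : Circ), 0) = V φ 1 (x.1.1.1 (φ, 0)) := by
    intro φ
    have h := return_map hf hv hV hT x φ
    simpa [hode, hbc, hp, deltaRhs_zero, hδT, hδρ] using h
  have hx0 : Continuous fun φ : Circ => x.1.1.1 (φ, 0) :=
    (map_continuous x.1.1.1).comp (by fun_prop)
  have hconst : ∀ {r : Circ → ℝ → Cov n}, IsCotangent ρ V r → ∀ φ : Circ,
      r φ 0 (x.1.1.1 (φ, 0)) = r 0 0 (x.1.1.1 (0, 0)) := by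
    intro r hr φ
    refine constant_of_rotation_invariant hρ (a := fun φ : Circ => r φ 0 (x.1.1.1 (φ, 0)))
      ((continuous_circle_of_prod hr.cont 0).clm_apply hx0) (fun φ => ?_) φ
    simp only [hret, ← hr.shift_one, hr.inv]
  set c : Fin 2 → ℝ := ![qτ 0 0 (x.1.1.1 (0, 0)), qφ 0 0 (x.1.1.1 (0, 0))] with hc
  let w : C(Circ, Vec n) := ⟨fun φ => qtr v qτ qφ φ 0 (x.1.1.1 (φ, 0)),
    (continuous_circle_of_prod (hq.continuous_qtr hf hv) 0).clm_apply hx0⟩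
  have hw : w = 0 := by
    refine hq.eq_zero_of_map_eq hV (fun φ => hq.qtr_qtr φ 0 _) fun φ => ?_
    change qtr v qτ qφ _ 0 _ = V φ 1 (qtr v qτ qφ _ 0 _)
    rw [hq.map_qtr, hret]
  have hu : ∀ φ : Circ, x.1.1.1 (φ, 0) = c 0 • dtau v φ 0 + c 1 • dphi v φ 0 := by
    intro φ
    have h : qtr v qτ qφ φ 0 (x.1.1.1 (φ, 0)) = 0 := DFunLike.congr_fun hw φ
    rw [qtr_apply, sub_eq_zero, hconst hrτ, hconst hrφ] at h
    exact h
  have hder : ∀ z : Strip, x.1.1.2 z = coeff f T p v z.1 z.2 (x.1.1.1 z) := by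
    intro z
    have h := DFunLike.congr_fun hode z
    simpa [linOde, hp, hδT, sub_eq_zero, coeff] using h
  have hsol : ∀ (φ : Circ) (τ : unitInterval), x.1.1.1 (φ, τ) =
      c 0 • dtau v φ τ + c 1 • dphi v φ τ := by
    intro φ τ
    rw [hV'.variation_of_constants x.1 φ τ]
    have hz : ∫ σ in (0 : ℝ)..τ, (V φ σ).inverse (x.1.1.2 (φ, projIcc 0 1 zero_le_one σ)
        - coeff f T p v φ σ (x.1.1.1 (φ, projIcc 0 1 zero_le_one σ))) = 0 := by
      refine intervalIntegral.integral_zero_ae (Filter.Eventually.of_forall fun σ hσ => ?_)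
      rw [uIoc_of_le τ.2.1] at hσ
      have hσ' : σ ∈ Icc (0 : ℝ) 1 := ⟨hσ.1.le, hσ.2.trans τ.2.2⟩
      rw [projIcc_of_mem zero_le_one hσ', hder, sub_self, map_zero]
    rw [hz, add_zero, hu, map_add, map_smul, map_smul, (hv.isTangent_dtau hf).map_eq hV',
      (hv.isTangent_dphi hf).map_eq hV']
  have hc0 : c = 0 := by
    refine Matrix.eq_zero_of_mulVec_eq_zero hK (funext fun i => ?_)
    rw [← integral_tangent_eq_mulVec hf hv K c i]
    have h := congr_arg (fun y : EuclideanSpace ℝ (Fin 2) => y i) hps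
    simpa [linPs, hp, hsol] using h
  have h1 : x.1.1.1 = 0 := by
    ext1 z
    rw [show z = (z.1, z.2) from rfl, hsol, hc0]
    simp
  have h2 : x.1.1.2 = 0 := by
    ext1 z
    rw [hder, h1]
    simp
  exact Prod.ext (Subtype.ext (Prod.ext h1 h2)) (Prod.ext hδT (Prod.ext hδρ hp))

end Transversal

/-! ### The adjoint problem -/

section Adjoint

variable {f : Vec n → Vec q → Vec n} {T ρ : ℝ} {p : Vec q} {v : Circ → ℝ → Vec n}
  {A V : Circ → ℝ → Vec n →L[ℝ] Vec n} {qτ qφ : Circ → ℝ → Cov n} {r : Circ → ℝ → Cov n}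
  {K : Fin 2 → C(Strip, Cov n)} {H : Fin 2 → Cov q}

theorem IsCotangent.apply_inverse (hr : IsCotangent ρ V r) (hV : IsFundamental A V) (φ : Circ)
    (τ : ℝ) (x : Vec n) : r φ 0 ((V φ τ).inverse x) = r φ τ x := by
  rw [← hr.inv φ τ, hV.self_apply_inverse]

theorem IsCotangent.apply_deltaRhs (hr : IsCotangent ρ V r) (hV : IsFundamental A V)
    (δode : C(Strip, Vec n)) (δbc : C(Circ, Vec n)) (φ : Circ) :
    r φ 1 (deltaRhs V δode δbc φ) = r φ 1 (δbc φ) + ∫ σ : unitInterval, r φ σ (δode (φ, σ)) := by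
  have hc : Continuous fun σ : unitInterval => (V φ σ).inverse (δode (φ, σ)) :=
    (continuous_strip_right hV.continuous_inverse φ).clm_apply
      (continuous_strip_right (map_continuous δode) φ)
  rw [deltaRhs, map_add, hr.inv, ← (r φ 0).integral_comp_comm (integrable_of_continuous hc)]
  simp only [hr.apply_inverse hV]

theorem IsCotangent.comp_PMat (hr : IsCotangent ρ V r) (hf : IsC1Field f) (hv : IsC1 v)
    (hV : IsFundamental A V) (φ : Circ) :
    (r φ 1).comp (PMat f T p v V φ 1) =
      ∫ σ in (0 : ℝ)..1, T • (r φ σ).comp (dp f (v φ σ) p) := by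
  have hW := continuous_strip_right hV.continuous_inverse φ
  have hp := continuous_strip_right (continuous_strip_of_prod (continuous_dp (p := p) hf hv)) φ
  have hrc := continuous_strip_right (continuous_strip_of_prod hr.cont) φ
  have hWp : Continuous fun σ : unitInterval => (V φ σ).inverse.comp (dp f (v φ σ) p) :=
    hW.clm_comp hp
  have hrp : Continuous fun σ : unitInterval => T • (r φ σ).comp (dp f (v φ σ) p) :=
    (hrc.clm_comp hp).const_smul T
  rw [← integral_unitInterval, PMat_one]
  ext1 x
  rw [integral_clm_comp_apply hrp]
  simp only [ContinuousLinearMap.comp_apply, smul_apply, map_smul, hr.inv]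
  rw [integral_clm_comp_apply hWp, ← (r φ 0).integral_comp_comm
    (integrable_of_continuous (hWp.clm_apply continuous_const)), integral_smul]
  simp only [ContinuousLinearMap.comp_apply, hr.apply_inverse hV]

theorem IsCotangent.apply_tangent (hr : IsCotangent ρ V r) (hV : IsFundamental A V)
    {e : Circ → ℝ → Vec n} (he : IsTangent ρ A e) (φ : Circ) (τ : ℝ) :
    r φ τ (e φ τ) = r φ 0 (e φ 0) := by
  rw [← he.map_eq hV, hr.inv]

theorem IsCotangent.linear_combination {r' : Circ → ℝ → Cov n} (hr : IsCotangent ρ V r)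
    (hr' : IsCotangent ρ V r') (a b : ℝ) :
    IsCotangent ρ V fun φ τ => a • r φ τ + b • r' φ τ where
  cont := (hr.cont.const_smul a).add (hr'.cont.const_smul b)
  inv φ τ x := by simp [hr.inv, hr'.inv]
  shift φ τ := by simp only [hr.shift, hr'.shift]

/-- Cotangent fields solve the adjoint equations. -/
theorem IsCotangent.isAdjointSolution (hr : IsCotangent ρ V r) (hf : IsC1Field f)
    (hv : IsTorusSolution f T ρ p v) (hV : IsVariationalSolution f T p v V) (hT : T ≠ 0) {a b : ℝ}
    (ha : ∀ φ, r φ 0 (dtau v φ 0) = a) (hb : ∀ φ, r φ 0 (dphi v φ 0) = b)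
    {ldE : Circ → ℝ → Cov n} {lbc : C(Circ, Cov n)} {etap : Cov q}
    (hde : ∀ φ, ∀ τ ∈ Icc (0 : ℝ) 1, ldE φ τ = r φ τ) (hbc : ∀ φ, lbc φ = r φ 1)
    (hp : etap = ∫ φ : Circ, (r φ 1).comp (PMat f T p v V φ 1)) :
    IsAdjointSolution f T ρ p v K H ldE lbc 0 (a / T) (-b) etap := by
  have hV' := hV.isFundamental hf hv.c1
  have h0 : (0 : ℝ) ∈ Icc (0 : ℝ) 1 := ⟨le_rfl, zero_le_one⟩
  have h1 : (1 : ℝ) ∈ Icc (0 : ℝ) 1 := ⟨zero_le_one, le_rfl⟩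
  refine ⟨fun φ τ => ?_, fun φ => ?_, fun φ => ?_, ?_, ?_, ?_⟩
  · have h := (hr.hasDerivAt hV' φ τ).hasDerivWithinAt (s := Icc (0 : ℝ) 1)
    refine (h.congr (fun s hs => hde φ s hs) (hde φ τ τ.2)).congr_deriv ?_
    rw [hde φ τ τ.2]
    ext1 x
    simp [coeff]
  · rw [hde φ 1 h1, hbc, sub_self]
  · rw [hde φ 0 h0, hbc, hr.shift_one, sub_add_cancel, neg_add_cancel]
  -- The integrand does not depend on `φ` or `τ`, since `T f = ∂_τ v` and the pairing of a row field
  -- with a tangent field is transported.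
  · have h : ∀ φ : Circ, ∫ τ in (0 : ℝ)..1, ldE φ τ (f (v φ τ) p) = a / T := by
      intro φ
      have hc : ∀ τ ∈ uIcc (0 : ℝ) 1, ldE φ τ (f (v φ τ) p) = a / T := by
        intro τ hτ
        rw [uIcc_of_le zero_le_one] at hτ
        have h2 := hr.apply_tangent hV' (hv.isTangent_dtau hf) φ τ
        rw [ha, hv.dtau_eq, map_smul, smul_eq_mul] at h2
        rw [hde φ τ hτ, eq_div_iff hT, mul_comm, h2]
      rw [intervalIntegral.integral_congr hc]
      simp
    simp only [h, integral_circle_const]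
    ring
  · have h : ∀ φ : Circ, lbc φ (dphi v (φ + (ρ : Circ)) 0) = b := by
      intro φ
      rw [hbc, hr.shift_one, hb]
    simp only [h, integral_circle_const]
    ring
  · have h : ∀ φ : Circ, ∫ τ in (0 : ℝ)..1, T • (ldE φ τ).comp (dp f (v φ τ) p) =
        (r φ 1).comp (PMat f T p v V φ 1) := by
      intro φ
      rw [hr.comp_PMat hf hv.c1 hV']
      refine intervalIntegral.integral_congr fun τ hτ => ?_
      rw [uIcc_of_le zero_le_one] at hτ
      simp only [hde φ τ hτ]
    simp only [h, hp]
    simp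

/-- A continuous field of row vectors that is invariant under the return map vanishes on the
transversal directions. -/
theorem IsNormallyHyperbolic.apply_qtr_eq_zero (hq : IsNormallyHyperbolic ρ v V qτ qφ)
    (hf : IsC1Field f) (hv : IsTorusSolution f T ρ p v) (hV : IsVariationalSolution f T p v V)
    {c : Circ → Cov n} (hc : Continuous c) (h : ∀ φ x, c (φ + (ρ : Circ)) (V φ 1 x) = c φ x)
    (φ : Circ) (x : Vec n) : c φ (qtr v qτ qφ φ 0 x) = 0 := by
  have hQ := continuous_circle_of_prod (hq.continuous_qtr hf hv) 0
  -- The Riesz vector of `c ∘ q_tr`, so that `c` applied to `q_tr y` is `‖y‖²`. Solving the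
  -- transversal return equation with right-hand side `q_tr y` makes `‖y‖²` a coboundary; its
  -- integral is then zero, and continuity gives `y = 0`.
  let y : C(Circ, Vec n) := ⟨fun φ => (InnerProductSpace.toDual ℝ (Vec n)).symm
    ((c φ).comp (qtr v qτ qφ φ 0)), (LinearIsometryEquiv.continuous _).comp (hc.clm_comp hQ)⟩
  have hy : ∀ φ x, inner ℝ (y φ) x = c φ (qtr v qτ qφ φ 0 x) := fun φ x =>
    InnerProductSpace.toDual_symm_apply
  let g : C(Circ, Vec n) := ⟨fun φ => qtr v qτ qφ φ 0 (y φ), hQ.clm_apply (map_continuous y)⟩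
  obtain ⟨w, -, hw⟩ := hq.exists_map_sub_eq hV (g := g) (fun φ => hq.qtr_qtr φ 0 _)
  have hcw : Continuous fun φ => c φ (w φ) := hc.clm_apply (map_continuous w)
  have hcws : Continuous fun φ : Circ => c (φ + (ρ : Circ)) (w (φ + (ρ : Circ))) :=
    hcw.comp (by fun_prop : Continuous fun φ : Circ => φ + (ρ : Circ))
  have hn : Continuous fun φ => ‖y φ‖ ^ 2 := (map_continuous y).norm.pow 2
  have e : ∀ φ : Circ, ‖y (φ + (ρ : Circ))‖ ^ 2 =
      c φ (w φ) - c (φ + (ρ : Circ)) (w (φ + (ρ : Circ))) := by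
    intro φ
    rw [← h φ, ← map_sub, hw, ← real_inner_self_eq_norm_sq, hy]
    rfl
  have hint : ∫ φ : Circ, ‖y φ‖ ^ 2 = 0 := by
    rw [← integral_add_right_eq_self (fun φ : Circ => ‖y φ‖ ^ 2) (ρ : Circ)]
    simp only [e]
    rw [integral_sub (integrable_of_continuous hcw) (integrable_of_continuous hcws),
      integral_add_right_eq_self (fun φ : Circ => c φ (w φ)) (ρ : Circ), sub_self]
  have hz := (integral_eq_zero_iff_of_nonneg (fun φ => by positivity)
    (integrable_of_continuous hn)).1 hint
  have hz' := congr_fun (hn.ae_eq_iff_eq volume continuous_zero |>.1 hz) φ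
  have hy0 : y φ = 0 := by simpa using hz'
  rw [← hy, hy0, inner_zero_left]

/-- This mirrors the injectivity proof on the dual side: the phase multipliers vanish, the
transversal part vanishes, and the two constant tangential components are read off from the
conditions for `T` and `ρ`. -/
theorem IsAdjointSolution.eq (hρ : Irrational ρ) (hf : IsC1Field f)
    (hv : IsTorusSolution f T ρ p v) (hV : IsVariationalSolution f T p v V)
    (hq : IsNormallyHyperbolic ρ v V qτ qφ) (hK : (phaseMatrix v K).det ≠ 0)
    {ldE : Circ → ℝ → Cov n} {lbc : C(Circ, Cov n)} {lps : Fin 2 → ℝ} {etaT etaρ : ℝ}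
    {etap : Cov q} (h : IsAdjointSolution f T ρ p v K H ldE lbc lps etaT etaρ etap) :
    lps = 0 ∧ ∀ φ, ∀ τ ∈ Icc (0 : ℝ) 1,
      ldE φ τ = (T * etaT) • qτ φ τ + (-etaρ) • qφ φ τ := by
  have hV' := hV.isFundamental hf hv.c1
  have hT := hq.T_ne_zero hv
  obtain ⟨hrτ, hrφ⟩ := hq.isCotangent hf hv hV
  have h1e : ∀ φ, ldE φ 1 = lbc φ := fun φ => (sub_eq_zero.1 (h.var_v1 φ).symm)
  have h0e : ∀ φ, ldE φ 0 = lbc (φ - (ρ : Circ)) := fun φ => by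
    have := h.var_v0 φ
    rwa [eq_comm, neg_add_eq_zero] at this
  -- Along a tangent field the transport terms of `λ_de` and `e` cancel, so `λ_de e` changes over
  -- one turn only through `λ_ps ∂_v h`. Averaged over the circle, the two boundary terms agree up
  -- to a rotation, and the total change is zero.
  have hjump : ∀ {e : Circ → ℝ → Vec n}, IsTangent ρ (coeff f T p v) e →
      ∑ i, lps i * ∫ φ : Circ, ∫ τ : unitInterval, K i (φ, τ) (e φ τ) = 0 := by
    intro e he
    have hec := continuous_strip_of_prod he.cont
    have hKe : ∀ i, Continuous fun z : Strip => K i z (e z.1 z.2) := fun i =>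
      (map_continuous (K i)).clm_apply hec
    let G : Circ → ℝ → ℝ := fun φ s => ∑ i, lps i * K i (φ, projIcc 0 1 zero_le_one s)
      (e φ (projIcc (0 : ℝ) 1 zero_le_one s))
    have hG : ∀ φ, Continuous (G φ) := fun φ => continuous_finsetSum _ fun i _ =>
      continuous_const.mul ((continuous_strip_right (hKe i) φ).comp continuous_projIcc)
    have hE : ∀ φ, ldE φ 1 (e φ 1) = ldE φ 0 (e φ 0) +
        ∫ τ : unitInterval, ∑ i, lps i * K i (φ, τ) (e φ τ) := by
      intro φ
      have h2 := eq_add_integral_of_hasDerivWithinAt (w := fun s => ldE φ s (e φ s))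
        (hG φ).continuousOn (fun s hs => ?_) (right_mem_Icc.2 zero_le_one)
      · rw [h2, ← integral_unitInterval]
        simp only [G, projIcc_val]
      · refine ((h.var_v φ ⟨s, hs⟩).clm_apply (he.ode φ s).hasDerivWithinAt).congr_deriv ?_
        simp [G, projIcc_of_mem zero_le_one hs, coeff]
    have hE' : ∀ φ : Circ, lbc φ (e (φ + (ρ : Circ)) 0) - lbc (φ - (ρ : Circ)) (e φ 0) =
        ∫ τ : unitInterval, ∑ i, lps i * K i (φ, τ) (e φ τ) := by
      intro φ
      rw [← h1e, ← h0e, ← he.shift_one, hE φ]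
      ring
    have c1 : Continuous fun φ : Circ => lbc (φ - (ρ : Circ)) (e φ 0) :=
      ((map_continuous lbc).comp (by fun_prop)).clm_apply (continuous_circle_of_prod he.cont 0)
    have c2 : Continuous fun φ : Circ => lbc φ (e (φ + (ρ : Circ)) 0) :=
      (map_continuous lbc).clm_apply ((continuous_circle_of_prod he.cont 0).comp
        (by fun_prop : Continuous fun φ : Circ => φ + (ρ : Circ)))
    have hint : ∫ φ : Circ, ∫ τ : unitInterval, ∑ i, lps i * K i (φ, τ) (e φ τ) = 0 := by
      simp only [← hE']
      rw [integral_sub (integrable_of_continuous c2) (integrable_of_continuous c1),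
        ← integral_add_right_eq_self (fun φ : Circ => lbc (φ - (ρ : Circ)) (e φ 0)) (ρ : Circ)]
      simp
    rw [integral_strip (fun z => ∑ i, lps i * K i z (e z.1 z.2)) (continuous_finsetSum _
      fun i _ => continuous_const.mul (hKe i)), integral_finsetSum _ (fun i _ =>
      (integrable_of_continuous (hKe i)).const_mul _)] at hint
    rw [← hint]
    refine Finset.sum_congr rfl fun i _ => ?_
    rw [integral_const_mul, integral_strip (fun z => K i z (e z.1 z.2)) (hKe i)]
  have hlps : lps = 0 := by
    -- The two tangent fields give the two columns of the phase matrix.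
    refine Matrix.eq_zero_of_vecMul_eq_zero hK (funext fun j => ?_)
    fin_cases j
    · simpa [Matrix.vecMul, dotProduct, phaseMatrix] using hjump (hv.isTangent_dtau hf)
    · simpa [Matrix.vecMul, dotProduct, phaseMatrix] using hjump (hv.isTangent_dphi hf)
  refine ⟨hlps, ?_⟩
  have htrans : ∀ φ x, ∀ τ ∈ Icc (0 : ℝ) 1, ldE φ τ (V φ τ x) = ldE φ 0 x := by
    intro φ x τ hτ
    have h2 := constant_of_hasDerivWithinAt_zero (w := fun s => ldE φ s (V φ s x))
      (fun s hs => ?_) hτ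
    · simpa [hV'.init] using h2
    · refine ((h.var_v φ ⟨s, hs⟩).clm_apply (((hV'.ode φ s).clm_apply
        (hasDerivAt_const s x)).hasDerivWithinAt)).congr_deriv ?_
      simp [hlps, coeff]
  have hcc : Continuous fun φ => ldE φ 0 := by
    simp only [h0e]
    exact (map_continuous lbc).comp (by fun_prop)
  have hshift : ∀ φ : Circ, ldE (φ + (ρ : Circ)) 0 = ldE φ 1 := fun φ => by
    rw [h0e, h1e, add_sub_cancel_right]
  have hinv : ∀ φ x, ldE (φ + (ρ : Circ)) 0 (V φ 1 x) = ldE φ 0 x := fun φ x => by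
    rw [hshift, htrans φ x 1 (right_mem_Icc.2 zero_le_one)]
  -- The tangential components are continuous and invariant under the irrational rotation.
  have hconst : ∀ {e : Circ → ℝ → Vec n}, IsTangent ρ (coeff f T p v) e → ∀ φ : Circ,
      ldE φ 0 (e φ 0) = ldE 0 0 (e 0 0) := by
    intro e he φ
    refine constant_of_rotation_invariant hρ (a := fun φ : Circ => ldE φ 0 (e φ 0))
      (hcc.clm_apply (continuous_circle_of_prod he.cont 0)) (fun φ => ?_) φ
    simp only [← he.shift_one, ← he.map_eq hV' φ 1, hinv]
  set α := ldE 0 0 (dtau v 0 0) with hα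
  set β := ldE 0 0 (dphi v 0 0) with hβ
  have hdec : ∀ φ x, ldE φ 0 x = α * qτ φ 0 x + β * qφ φ 0 x := by
    intro φ x
    have h2 := hq.apply_qtr_eq_zero hf hv hV hcc hinv φ x
    rw [qtr_apply, map_sub, map_add, map_smul, map_smul, hconst (hv.isTangent_dtau hf),
      hconst (hv.isTangent_dphi hf), sub_eq_zero] at h2
    rw [h2, smul_eq_mul, smul_eq_mul]
    ring
  have hsol : ∀ φ, ∀ τ ∈ Icc (0 : ℝ) 1, ldE φ τ = α • qτ φ τ + β • qφ φ τ := by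
    intro φ τ hτ
    ext1 x
    rw [← hV'.self_apply_inverse φ τ x, htrans φ _ τ hτ, hdec]
    simp [hrτ.inv, hrφ.inv]
  have hαT : α = T * etaT := by
    have h2 : ∀ φ : Circ, ∫ τ in (0 : ℝ)..1, ldE φ τ (f (v φ τ) p) = α / T := by
      intro φ
      have h3 : ∀ τ ∈ uIcc (0 : ℝ) 1, ldE φ τ (f (v φ τ) p) = α / T := by
        intro τ hτ
        rw [uIcc_of_le zero_le_one] at hτ
        have h4 : ldE φ τ (dtau v φ τ) = α := by
          simp [hsol φ τ hτ, hq.dual_dtau φ τ]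
        rw [hv.dtau_eq, map_smul, smul_eq_mul] at h4
        rw [eq_div_iff hT, mul_comm, h4]
      rw [intervalIntegral.integral_congr h3]
      simp
    have h5 := h.var_T
    simp only [h2, integral_circle_const] at h5
    have h6 : etaT = α / T := by linarith
    rw [h6, mul_div_cancel₀ _ hT]
  have hβρ : β = -etaρ := by
    have h2 : ∀ φ : Circ, lbc φ (dphi v (φ + (ρ : Circ)) 0) = β := by
      intro φ
      rw [← h1e, ← hshift, hconst (hv.isTangent_dphi hf)]
    have h5 := h.var_ρ
    simp only [h2, integral_circle_const] at h5
    linarith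
  rw [← hαT, ← hβρ]
  exact hsol

/-- Existence and uniqueness of the adjoint variables. -/
theorem isAdjointSolution_iff (hρ : Irrational ρ) (hf : IsC1Field f)
    (hv : IsTorusSolution f T ρ p v) (hV : IsVariationalSolution f T p v V)
    (hq : IsNormallyHyperbolic ρ v V qτ qφ) (hK : (phaseMatrix v K).det ≠ 0) {etaT etaρ : ℝ}
    (hr : r = fun φ τ => (T * etaT) • qτ φ τ + (-etaρ) • qφ φ τ)
    {ldE : Circ → ℝ → Cov n} {lbc : C(Circ, Cov n)} {lps : Fin 2 → ℝ}
    {etap : Cov q} : IsAdjointSolution f T ρ p v K H ldE lbc lps etaT etaρ etap ↔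
      (∀ φ, ∀ τ ∈ Icc (0 : ℝ) 1, ldE φ τ = r φ τ) ∧ (∀ φ, lbc φ = r φ 1) ∧
      lps = 0 ∧ etap = ∫ φ : Circ, (r φ 1).comp (PMat f T p v V φ 1) := by
  have hT := hq.T_ne_zero hv
  obtain ⟨hrτ, hrφ⟩ := hq.isCotangent hf hv hV
  have hrc : IsCotangent ρ V r := hr ▸ hrτ.linear_combination hrφ _ _
  have ha : ∀ φ, r φ 0 (dtau v φ 0) = T * etaT := fun φ => by simp [hr, hq.dual_dtau φ 0]
  have hb : ∀ φ, r φ 0 (dphi v φ 0) = -etaρ := fun φ => by simp [hr, hq.dual_dphi φ 0]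
  constructor
  · intro h
    obtain ⟨h1, h2⟩ := h.eq hρ hf hv hV hq hK
    have h2' : ∀ φ, ∀ τ ∈ Icc (0 : ℝ) 1, ldE φ τ = r φ τ := by rw [hr]; exact h2
    have h3 : ∀ φ, lbc φ = r φ 1 := fun φ => by
      rw [← h2' φ 1 (right_mem_Icc.2 zero_le_one), ← sub_eq_zero.1 (h.var_v1 φ).symm]
    -- The explicit solution satisfies the same condition for `p` with the same `λ_de`; once `λ_ps =
    -- 0` that condition determines `η_p`.
    have h4 := (hrc.isAdjointSolution (K := K) (H := H) hf hv hV hT ha hb h2' h3 rfl).var_p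
    have h5 := h.var_p
    refine ⟨h2', h3, h1, ?_⟩
    simp only [h1, Pi.zero_apply, zero_smul, Finset.sum_const_zero, add_zero] at h4 h5
    exact add_left_cancel (h5.symm.trans h4)
  · rintro ⟨h1, h2, rfl, h3⟩
    have h := hrc.isAdjointSolution (K := K) (H := H) hf hv hV hT ha hb h1 h2 h3
    rwa [mul_div_cancel_left₀ _ hT, neg_neg] at h

end Adjoint

/-! ### Bounded rows of the inverse -/

section BoundedRows

variable {f : Vec n → Vec q → Vec n} {T ρ : ℝ} {p : Vec q} {v : Circ → ℝ → Vec n}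
  {V : Circ → ℝ → Vec n →L[ℝ] Vec n} {qτ qφ : Circ → ℝ → Cov n} {r : Circ → ℝ → Cov n}
  {K : Fin 2 → C(Strip, Cov n)} {H : Fin 2 → Cov q}

theorem exists_integral_clm {X : Type*} [TopologicalSpace X] [CompactSpace X] [MeasurableSpace X]
    [OpensMeasurableSpace X] (μ : Measure X) [IsFiniteMeasure μ] (g : C(X, Cov n)) :
    ∃ Φ : C(X, Vec n) →L[ℝ] ℝ, ∀ w, Φ w = ∫ x, g x (w x) ∂μ := by
  have hc : ∀ w : C(X, Vec n), Continuous fun x => g x (w x) := fun w =>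
    (map_continuous g).clm_apply (map_continuous w)
  let Φ : C(X, Vec n) →ₗ[ℝ] ℝ :=
    { toFun := fun w => ∫ x, g x (w x) ∂μ
      map_add' := fun w w' => by
        rw [← integral_add (integrable_of_continuous (hc w)) (integrable_of_continuous (hc w'))]
        simp
      map_smul' := fun c w => by
        rw [RingHom.id_apply, ← integral_smul]
        simp }
  refine ⟨Φ.mkContinuous (‖g‖ * μ.real univ) fun w => ?_, fun w => rfl⟩
  have h : ∀ x, ‖g x (w x)‖ ≤ ‖g‖ * ‖w‖ := fun x =>
    ((g x).le_opNorm _).trans (mul_le_mul (g.norm_coe_le_norm x) (w.norm_coe_le_norm x)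
      (norm_nonneg _) (norm_nonneg g))
  refine (norm_integral_le_of_norm_le_const (Filter.Eventually.of_forall h)).trans (le_of_eq ?_)
  ring

/-- The adjoint pairing with `λ_ps = 0`: integration against continuous densities is bounded in the
sup-norm, and `δ_h` does not enter. -/
theorem IsCotangent.exists_pairing_clm (hr : IsCotangent ρ V r) (etap : Cov q) :
    ∃ R : Violations n × Vec q →L[ℝ] ℝ, ∀ y, R y =
      -((∫ φ : Circ, ∫ τ : unitInterval, r φ τ (y.1.1 (φ, τ))) + (∫ φ : Circ, r φ 1 (y.1.2.1 φ))
        + etap y.2) := by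
  let g₁ : C(Strip, Cov n) := ⟨fun z => r z.1 z.2, continuous_strip_of_prod hr.cont⟩
  let g₂ : C(Circ, Cov n) := ⟨fun φ => r φ 1, continuous_circle_of_prod hr.cont 1⟩
  obtain ⟨Φ₁, h₁⟩ := exists_integral_clm volume g₁
  obtain ⟨Φ₂, h₂⟩ := exists_integral_clm volume g₂
  refine ⟨-(Φ₁.comp ((ContinuousLinearMap.fst ℝ _ _).comp (ContinuousLinearMap.fst ℝ _ _))
    + Φ₂.comp ((ContinuousLinearMap.fst ℝ _ _).comp ((ContinuousLinearMap.snd ℝ _ _).comp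
      (ContinuousLinearMap.fst ℝ _ _))) + etap.comp (ContinuousLinearMap.snd ℝ _ _)),
    fun y => ?_⟩
  have e : ∫ φ : Circ, ∫ τ : unitInterval, r φ τ (y.1.1 (φ, τ)) = ∫ z, g₁ z (y.1.1 z) :=
    integral_strip (fun z => g₁ z (y.1.1 z))
      ((map_continuous g₁).clm_apply (map_continuous y.1.1))
  rw [e, ← h₁]
  have e2 : ∫ φ : Circ, r φ 1 (y.1.2.1 φ) = Φ₂ y.1.2.1 := (h₂ _).symm
  rw [e2]
  rfl

/-- The mean equation with `δ_rhs` resolved into `δ_ode` and `δ_bc`, so that it becomes the adjoint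
pairing. -/
theorem IsCotangent.pairing_linearization (hr : IsCotangent ρ V r) (hf : IsC1Field f)
    (hv : IsTorusSolution f T ρ p v) (hV : IsVariationalSolution f T p v V) (hT : T ≠ 0) {a b : ℝ}
    (ha : ∀ φ, r φ 0 (dtau v φ 0) = a) (hb : ∀ φ, r φ 0 (dphi v φ 0) = b) (x : Unknowns n q) :
    (∫ φ : Circ, ∫ τ : unitInterval, r φ τ (linOde hf T p hv.c1 x (φ, τ)))
      + (∫ φ : Circ, r φ 1 (linBc ρ hv.c1 x φ))
      + (∫ φ : Circ, (r φ 1).comp (PMat f T p v V φ 1)) x.2.2.2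
      = -(x.2.1 / T) * a + x.2.2.1 * b := by
  have hV' := hV.isFundamental hf hv.c1
  rw [← hr.mean hf hv hV hT ha hb x]
  simp only [hr.apply_deltaRhs hV']
  have c1 : Continuous fun φ : Circ => r φ 1 (linBc ρ hv.c1 x φ) :=
    (continuous_circle_of_prod hr.cont 1).clm_apply (map_continuous _)
  have c2 : Continuous fun φ : Circ =>
      ∫ τ : unitInterval, r φ τ (linOde hf T p hv.c1 x (φ, τ)) :=
    continuous_integral_unitInterval (g := fun z => r z.1 z.2 (linOde hf T p hv.c1 x z))
      ((continuous_strip_of_prod hr.cont).clm_apply (map_continuous _))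
  rw [integral_add (integrable_of_continuous c1) (integrable_of_continuous c2)]
  ring

/-- The adjoint variables represent bounded functionals of the data. -/
theorem exists_bounded_row (hρ : Irrational ρ) (hf : IsC1Field f)
    (hv : IsTorusSolution f T ρ p v) (hV : IsVariationalSolution f T p v V)
    (hq : IsNormallyHyperbolic ρ v V qτ qφ) (hK : (phaseMatrix v K).det ≠ 0) {etaT etaρ : ℝ}
    (hr : r = fun φ τ => (T * etaT) • qτ φ τ + (-etaρ) • qφ φ τ) :
    ∃ R : Violations n × Vec q →L[ℝ] ℝ,
      (∀ x, R (linReduced hf T ρ p hv.c1 K H x) = etaT * x.2.1 + etaρ * x.2.2.1) ∧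
      (∀ (ldE : Circ → ℝ → Cov n) (lbc : C(Circ, Cov n)) (lps : Fin 2 → ℝ) (etap : Cov q),
        IsAdjointSolution f T ρ p v K H ldE lbc lps etaT etaρ etap →
          ∀ y, R y = -adjointPairing ldE lbc lps etap y) ∧
      (∀ δp : Vec q, R (0, δp) = -((∫ φ : Circ, (r φ 1).comp (PMat f T p v V φ 1)) δp)) ∧
      ∀ δh : EuclideanSpace ℝ (Fin 2), R ((0, 0, δh), 0) = 0 := by
  have hT := hq.T_ne_zero hv
  obtain ⟨hrτ, hrφ⟩ := hq.isCotangent hf hv hV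
  have hrc : IsCotangent ρ V r := hr ▸ hrτ.linear_combination hrφ _ _
  have ha : ∀ φ, r φ 0 (dtau v φ 0) = T * etaT := fun φ => by simp [hr, hq.dual_dtau φ 0]
  have hb : ∀ φ, r φ 0 (dphi v φ 0) = -etaρ := fun φ => by simp [hr, hq.dual_dphi φ 0]
  obtain ⟨R, hR⟩ := hrc.exists_pairing_clm (∫ φ : Circ, (r φ 1).comp (PMat f T p v V φ 1))
  refine ⟨R, fun x => ?_, fun ldE lbc lps etap h y => ?_, fun δp => ?_, fun δh => ?_⟩
  · have h := hrc.pairing_linearization hf hv hV hT ha hb x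
    rw [hR]
    refine (congr_arg Neg.neg h).trans ?_
    field_simp
    ring
  · obtain ⟨h1, h2, h3, h4⟩ := (isAdjointSolution_iff hρ hf hv hV hq hK hr).1 h
    have e : ∀ φ : Circ, ∀ τ : unitInterval, ldE φ τ = r φ τ := fun φ τ => h1 φ τ τ.2
    rw [hR, adjointPairing, ← h4, h3]
    simp only [e, h2]
    simp
  · rw [hR]
    simp
  · rw [hR]
    simp

end BoundedRows

/-! ### Approximate solution of the cohomological equation -/

section Cohomological

theorem fourier_translate (k : ℤ) (φ : Circ) (ρ : ℝ) :
    fourier k (φ + (ρ : Circ)) = Complex.exp (2 * Real.pi * Complex.I * k * ρ) * fourier k φ := by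
  obtain ⟨s, rfl⟩ := QuotientAddGroup.mk_surjective φ
  rw [show (QuotientAddGroup.mk s : Circ) + (ρ : Circ) = ((s + ρ : ℝ) : Circ) from rfl,
    fourier_coe_apply, fourier_coe_apply, ← Complex.exp_add]
  congr 1
  push_cast
  ring

/-- The operator `(a, c) ↦ a(· + ρ) - a + c`. -/
noncomputable def coboundary (ρ : ℝ) : C(Circ, ℂ) × ℂ →ₗ[ℂ] C(Circ, ℂ) where
  toFun z := z.1.comp ⟨fun φ => φ + (ρ : Circ), by fun_prop⟩ - z.1 + ContinuousMap.const _ z.2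
  map_add' z w := by
    ext φ
    simp only [ContinuousMap.add_apply, ContinuousMap.sub_apply, ContinuousMap.comp_apply,
      ContinuousMap.coe_mk, ContinuousMap.const_apply, Prod.fst_add, Prod.snd_add]
    ring
  map_smul' c z := by
    ext φ
    simp only [ContinuousMap.add_apply, ContinuousMap.sub_apply, ContinuousMap.comp_apply,
      ContinuousMap.coe_mk, ContinuousMap.const_apply, Prod.smul_fst, Prod.smul_snd,
      ContinuousMap.smul_apply, smul_eq_mul, RingHom.id_apply]
    ring

theorem coboundary_apply (ρ : ℝ) (z : C(Circ, ℂ) × ℂ) (φ : Circ) :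
    coboundary ρ z φ = z.1 (φ + (ρ : Circ)) - z.1 φ + z.2 := rfl

/-- The constant `c` produces the mode `k = 0`. Every other character is an eigenfunction of `a ↦
a(· + ρ) - a` with nonzero eigenvalue, so the range contains all trigonometric polynomials. -/
theorem coboundary_dense {ρ : ℝ} (hρ : Irrational ρ) :
    (LinearMap.range (coboundary ρ)).topologicalClosure = ⊤ := by
  rw [eq_top_iff, ← span_fourier_closure_eq_top (T := (1 : ℝ))]
  refine Submodule.topologicalClosure_mono (Submodule.span_le.2 ?_)
  rintro _ ⟨k, rfl⟩
  by_cases hk : k = 0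
  · refine ⟨(0, 1), ?_⟩
    ext φ
    simp [coboundary_apply, hk]
  · have h := small_divisor_ne_zero hρ (neg_ne_zero.2 hk)
    have h' : Complex.exp (2 * Real.pi * Complex.I * k * ρ) - 1 ≠ 0 := by
      rw [← neg_ne_zero, neg_sub]
      convert h using 4
      push_cast
      ring
    refine ⟨((Complex.exp (2 * Real.pi * Complex.I * k * ρ) - 1)⁻¹ • fourier k, 0), ?_⟩
    ext φ
    simp only [coboundary_apply, ContinuousMap.smul_apply, smul_eq_mul, fourier_translate]
    field_simp
    ring

/-- The cohomological equation over an irrational rotation is approximately solvable. -/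
theorem exists_approx_coboundary {ρ : ℝ} (hρ : Irrational ρ) (g : C(Circ, ℝ)) {ε : ℝ}
    (hε : 0 < ε) : ∃ (a : C(Circ, ℝ)) (c : ℝ), ∀ φ, |a (φ + (ρ : Circ)) - a φ + c - g φ| ≤ ε := by
  let gc : C(Circ, ℂ) := ⟨fun φ => (g φ : ℂ), Complex.continuous_ofReal.comp (map_continuous g)⟩
  have hg : gc ∈ closure (LinearMap.range (coboundary ρ) : Set C(Circ, ℂ)) := by
    rw [← Submodule.topologicalClosure_coe, coboundary_dense hρ]
    trivial
  obtain ⟨_, ⟨z, rfl⟩, hz⟩ := Metric.mem_closure_iff.1 hg ε hε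
  refine ⟨⟨fun φ => (z.1 φ).re, Complex.continuous_re.comp (map_continuous z.1)⟩, z.2.re,
    fun φ => ?_⟩
  have h1 := (ContinuousMap.dist_apply_le_dist (f := gc) (g := coboundary ρ z) φ).trans hz.le
  rw [dist_comm, dist_eq_norm] at h1
  refine le_trans ?_ ((Complex.abs_re_le_norm _).trans h1)
  simp [coboundary_apply, gc]

end Cohomological

/-! ### Solvability and dense range -/

section Solvability

variable {f : Vec n → Vec q → Vec n} {T ρ : ℝ} {p : Vec q} {v : Circ → ℝ → Vec n}
  {A V : Circ → ℝ → Vec n →L[ℝ] Vec n} {qτ qφ : Circ → ℝ → Cov n}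
  {K : Fin 2 → C(Strip, Cov n)} {H : Fin 2 → Cov q}

/-- The inhomogeneous linear equation with prescribed initial values. -/
theorem IsFundamental.exists_solution (hV : IsFundamental A V) (u : C(Circ, Vec n))
    (g : C(Strip, Vec n)) : ∃ w : StripFun n, (∀ φ, w.1.1 (φ, 0) = u φ) ∧
      ∀ z : Strip, w.1.2 z = A z.1 z.2 (w.1.1 z) + g z := by
  let k : Strip → ℝ → Vec n := fun z σ => (V z.1 (projIcc (0 : ℝ) 1 zero_le_one σ)).inverse
    (g (z.1, projIcc 0 1 zero_le_one σ))
  have hk : Continuous (Function.uncurry k) := by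
    have hm : Continuous fun y : Strip × ℝ => ((y.1.1, projIcc 0 1 zero_le_one y.2) : Strip) :=
      (continuous_fst.comp continuous_fst).prodMk (continuous_projIcc.comp continuous_snd)
    exact (hV.continuous_inverse.comp hm).clm_apply ((map_continuous g).comp hm)
  have hw1 : Continuous fun z : Strip => V z.1 z.2 (u z.1 + ∫ σ in (0 : ℝ)..z.2, k z σ) :=
    hV.continuous.clm_apply (((map_continuous u).comp continuous_fst).add
      (intervalIntegral.continuous_parametric_intervalIntegral_of_continuous hk
        (continuous_subtype_val.comp continuous_snd)))
  have hw2 : Continuous fun z : Strip =>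
      A z.1 z.2 (V z.1 z.2 (u z.1 + ∫ σ in (0 : ℝ)..z.2, k z σ)) + g z :=
    ((continuous_strip_of_prod hV.cont).clm_apply hw1).add (map_continuous g)
  refine ⟨⟨(⟨_, hw1⟩, ⟨_, hw2⟩), fun φ τ => ?_⟩, fun φ => ?_, fun z => rfl⟩
  · have hkc : Continuous (k (φ, 0)) := hk.uncurry_left (φ, (0 : unitInterval))
    have h := (hV.ode φ τ).clm_apply ((intervalIntegral.integral_hasDerivAt_right
      (hkc.intervalIntegrable 0 τ) (hkc.stronglyMeasurableAtFilter _ _)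
      hkc.continuousAt).const_add (u φ))
    refine (h.hasDerivWithinAt (s := Icc (0 : ℝ) 1)).congr_of_mem (fun s hs => ?_) τ.2
      |>.congr_deriv ?_
    · simp only [ContinuousMap.coe_mk, projIcc_of_mem zero_le_one hs, k]
    · simp only [ContinuousMap.coe_mk, k, projIcc_val, hV.self_apply_inverse,
        ContinuousLinearMap.comp_apply]
  · simp [hV.init]

/-- The variations `a(φ) e(φ, τ)` for a tangent field `e`. -/
noncomputable def tangentField (hA : Continuous fun z : Circ × ℝ => A z.1 z.2)
    {e : Circ → ℝ → Vec n} (he : IsTangent ρ A e) : C(Circ, ℝ) →ₗ[ℝ] StripFun n where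
  toFun a := ⟨(⟨fun z => a z.1 • e z.1 z.2, ((map_continuous a).comp continuous_fst).smul
      (continuous_strip_of_prod he.cont)⟩,
    ⟨fun z => a z.1 • A z.1 z.2 (e z.1 z.2), ((map_continuous a).comp continuous_fst).smul
      (continuous_strip_of_prod (hA.clm_apply he.cont))⟩), fun φ τ => by
    refine ((he.ode φ τ).const_smul (a φ)).hasDerivWithinAt.congr_of_mem (fun s hs => ?_) τ.2
    simp [projIcc_of_mem zero_le_one hs]⟩
  map_add' a b := by
    refine Subtype.ext (Prod.ext ?_ ?_) <;> ext1 z <;> simp [add_smul]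
  map_smul' c a := by
    refine Subtype.ext (Prod.ext ?_ ?_) <;> ext1 z <;> simp [mul_smul]

/-- The variations `(a(φ) e(φ, τ), 0, 0, 0)` for a tangent field `e`. -/
noncomputable def tangentUnknown (q : ℕ) (hA : Continuous fun z : Circ × ℝ => A z.1 z.2)
    {e : Circ → ℝ → Vec n} (he : IsTangent ρ A e) : C(Circ, ℝ) →ₗ[ℝ] Unknowns n q :=
  LinearMap.inl ℝ (StripFun n) (ℝ × ℝ × Vec q) ∘ₗ tangentField hA he

theorem linOde_tangentUnknown (hf : IsC1Field f) (hv : IsC1 v)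
    (hA : Continuous fun z : Circ × ℝ => coeff f T p v z.1 z.2) {e : Circ → ℝ → Vec n}
    (he : IsTangent ρ (coeff f T p v) e) (a : C(Circ, ℝ)) :
    linOde hf T p hv (tangentUnknown q hA he a) = 0 := by
  ext1 z
  simp [linOde, tangentUnknown, tangentField, coeff, smul_comm T]

/-- Amplitudes that are constant along the torus produce no defect, and slowly varying ones along
the rotation produce little. The first fact serves the phase conditions, the second the
unboundedness. -/
theorem linBc_tangentUnknown (hv : IsC1 v) (hA : Continuous fun z : Circ × ℝ => A z.1 z.2)
    {e : Circ → ℝ → Vec n} (he : IsTangent ρ A e) (a : C(Circ, ℝ)) (φ : Circ) :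
    linBc ρ hv (tangentUnknown q hA he a) φ = (a (φ + (ρ : Circ)) - a φ) • e φ 1 := by
  simp [linBc, tangentUnknown, tangentField, he.shift_one, sub_smul]

/-- The phase conditions can be satisfied by shifts along the torus. -/
theorem exists_shift (hf : IsC1Field f) (hv : IsTorusSolution f T ρ p v)
    (hK : (phaseMatrix v K).det ≠ 0) (δh : EuclideanSpace ℝ (Fin 2)) :
    ∃ x : Unknowns n q, linReduced hf T ρ p hv.c1 K H x = ((0, 0, δh), 0) := by
  have hA := continuous_coeff (T := T) (p := p) hf hv.c1
  set c : Fin 2 → ℝ := (phaseMatrix v K)⁻¹.mulVec δh with hc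
  have hMc : (phaseMatrix v K).mulVec c = δh := by
    rw [hc, Matrix.mulVec_mulVec, Matrix.mul_nonsing_inv _ (isUnit_iff_ne_zero.2 hK),
      Matrix.one_mulVec]
  refine ⟨tangentUnknown q hA (hv.isTangent_dtau hf) (ContinuousMap.const _ (c 0))
    + tangentUnknown q hA (hv.isTangent_dphi hf) (ContinuousMap.const _ (c 1)), ?_⟩
  rw [map_add]
  refine Prod.ext (Prod.ext ?_ (Prod.ext ?_ ?_)) ?_
  · change linOde hf T p hv.c1 _ + linOde hf T p hv.c1 _ = 0
    rw [linOde_tangentUnknown, linOde_tangentUnknown, add_zero]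
  · change linBc ρ hv.c1 _ + linBc ρ hv.c1 _ = 0
    ext1 φ
    rw [ContinuousMap.add_apply, linBc_tangentUnknown, linBc_tangentUnknown]
    simp
  · change linPs K H _ + linPs K H _ = δh
    rw [← linPs_add]
    ext i
    rw [← hMc, ← integral_tangent_eq_mulVec hf hv K c i]
    simp [linPs, tangentUnknown, tangentField]
  · change (0 : Vec q) + 0 = 0
    rw [add_zero]

/-- Solvability of the return equation, given solutions of the two cohomological equations for the
tangential components. -/
theorem exists_return_solution (hf : IsC1Field f) (hv : IsTorusSolution f T ρ p v)
    (hV : IsVariationalSolution f T p v V) (hq : IsNormallyHyperbolic ρ v V qτ qφ)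
    {m : Circ → Vec n} (hmc : Continuous m) {a b : C(Circ, ℝ)} {c d : ℝ}
    (ha : ∀ φ, qτ φ 1 (m φ) = a (φ + (ρ : Circ)) - a φ + c)
    (hb : ∀ φ, qφ φ 1 (m φ) = b (φ + (ρ : Circ)) - b φ + d) :
    ∃ u : C(Circ, Vec n), ∀ φ, u (φ + (ρ : Circ)) = V φ 1 (u φ) + m φ
      - c • dtau v (φ + (ρ : Circ)) 0 - d • dphi v (φ + (ρ : Circ)) 0 := by
  have hV' := hV.isFundamental hf hv.c1
  have htτ := hv.isTangent_dtau hf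
  have htφ := hv.isTangent_dphi hf
  obtain ⟨hrτ, hrφ⟩ := hq.isCotangent hf hv hV
  have hQ := continuous_circle_of_prod (hq.continuous_qtr hf hv) 0
  -- The return equation has `w(φ + ρ)` on the left, opposite to `Γ`, hence the minus sign; the
  -- argument `φ - ρ` moves `m` to the base point where it acts.
  let G : C(Circ, Vec n) := ⟨fun φ => -qtr v qτ qφ φ 0 (m (φ - (ρ : Circ))),
    (hQ.clm_apply (hmc.comp (by fun_prop))).neg⟩
  obtain ⟨w, -, hw⟩ := hq.exists_map_sub_eq hV (g := G) (fun φ => by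
    change qtr v qτ qφ φ 0 (-qtr v qτ qφ φ 0 _) = -qtr v qτ qφ φ 0 _
    rw [map_neg, hq.qtr_qtr])
  refine ⟨⟨fun φ => a φ • dtau v φ 0 + b φ • dphi v φ 0 + w φ,
    (((map_continuous a).smul (continuous_circle_of_prod htτ.cont 0)).add
      ((map_continuous b).smul (continuous_circle_of_prod htφ.cont 0))).add (map_continuous w)⟩,
    fun φ => ?_⟩
  have hw' : V φ 1 (w φ) = -qtr v qτ qφ (φ + (ρ : Circ)) 0 (m φ) + w (φ + (ρ : Circ)) := by
    have h := hw φ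
    simp only [G, ContinuousMap.coe_mk, add_sub_cancel_right] at h
    exact sub_eq_iff_eq_add.1 h
  simp only [ContinuousMap.coe_mk, map_add, map_smul, hw', htτ.map_eq hV', htφ.map_eq hV',
    htτ.shift_one, htφ.shift_one, qtr_apply, ← hrτ.shift_one, ← hrφ.shift_one, ha, hb]
  module

/-- The constants of the two cohomological equations dictate `δ_T = -T c` and `δ_ρ = d`. -/
theorem exists_violation_preimage (hf : IsC1Field f) (hv : IsTorusSolution f T ρ p v)
    (hV : IsVariationalSolution f T p v V) (hq : IsNormallyHyperbolic ρ v V qτ qφ)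
    (δode : C(Strip, Vec n)) (δbc : C(Circ, Vec n)) (δp : Vec q) {a b : C(Circ, ℝ)} {c d : ℝ}
    (ha : ∀ φ, qτ φ 1 (deltaRhs V δode δbc φ + PMat f T p v V φ 1 δp) =
      a (φ + (ρ : Circ)) - a φ + c)
    (hb : ∀ φ, qφ φ 1 (deltaRhs V δode δbc φ + PMat f T p v V φ 1 δp) =
      b (φ + (ρ : Circ)) - b φ + d) :
    ∃ x : Unknowns n q, linOde hf T p hv.c1 x = δode ∧ linBc ρ hv.c1 x = δbc ∧ x.2.2.2 = δp := by
  have hV' := hV.isFundamental hf hv.c1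
  have hT := hq.T_ne_zero hv
  have hmc : Continuous fun φ => deltaRhs V δode δbc φ + PMat f T p v V φ 1 δp :=
    (continuous_deltaRhs hV' _ _).add
      ((continuous_PMat hf hv.c1 hV').clm_apply continuous_const)
  obtain ⟨u, hu⟩ := exists_return_solution hf hv hV hq hmc ha hb
  have h1 : Continuous fun z : Strip => (-(T * c)) • f (v z.1 z.2) p :=
    (continuous_strip_of_prod (g := fun z : Circ × ℝ => f (v z.1 z.2) p)
      ((hf.continuous p).comp hv.c1.continuous)).const_smul (-(T * c))
  have h2 : Continuous fun z : Strip => T • dp f (v z.1 z.2) p δp :=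
    ((continuous_strip_of_prod (continuous_dp hf hv.c1)).clm_apply continuous_const).const_smul T
  have hg : Continuous fun z : Strip => δode z + (-(T * c)) • f (v z.1 z.2) p
      + T • dp f (v z.1 z.2) p δp := ((map_continuous δode).add h1).add h2
  obtain ⟨δv, hδ0, hδ⟩ := hV'.exists_solution u ⟨_, hg⟩
  have hode : linOde hf T p hv.c1 (δv, -(T * c), d, δp) = δode := by
    ext1 z
    simp only [linOde, ContinuousMap.coe_mk, hδ z, coeff, smul_apply]
    abel
  refine ⟨(δv, -(T * c), d, δp), hode, ?_, rfl⟩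
  ext1 φ
  -- The return map expresses `u(φ + ρ)` through the actual boundary defect; comparison with the
  -- equation that defines `u` identifies this defect as `δ_bc`.
  have h := return_map hf hv hV hT (δv, -(T * c), d, δp) φ
  have e : -(T * c) / T = -c := by field_simp
  rw [hode] at h
  simp only [hδ0, hu φ, e, deltaRhs] at h
  generalize linBc ρ hv.c1 (δv, -(T * c), d, δp) φ = l at h ⊢
  rw [← sub_eq_zero] at h ⊢
  rw [← neg_eq_zero, ← h]
  module

/-- A shift along the torus corrects the phase conditions without disturbing the other equations. -/
theorem exists_preimage (hf : IsC1Field f) (hv : IsTorusSolution f T ρ p v)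
    (hV : IsVariationalSolution f T p v V) (hq : IsNormallyHyperbolic ρ v V qτ qφ)
    (hK : (phaseMatrix v K).det ≠ 0) (y : Violations n × Vec q) {a b : C(Circ, ℝ)} {c d : ℝ}
    (ha : ∀ φ, qτ φ 1 (deltaRhs V y.1.1 y.1.2.1 φ + PMat f T p v V φ 1 y.2) =
      a (φ + (ρ : Circ)) - a φ + c)
    (hb : ∀ φ, qφ φ 1 (deltaRhs V y.1.1 y.1.2.1 φ + PMat f T p v V φ 1 y.2) =
      b (φ + (ρ : Circ)) - b φ + d) :
    ∃ x : Unknowns n q, linReduced hf T ρ p hv.c1 K H x = y := by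
  obtain ⟨x, hode, hbc, hp⟩ := exists_violation_preimage hf hv hV hq y.1.1 y.1.2.1 y.2 ha hb
  obtain ⟨s, hs⟩ := exists_shift (H := H) hf hv hK (y.1.2.2 - linPs K H x)
  refine ⟨x + s, ?_⟩
  rw [map_add, hs]
  refine Prod.ext (Prod.ext ?_ (Prod.ext ?_ ?_)) ?_
  · exact (add_zero _).trans hode
  · exact (add_zero _).trans hbc
  · exact add_sub_cancel (linPs K H x) _
  · exact (add_zero _).trans hp

/-- Only the two scalar cohomological equations obstruct solvability. They are solved approximately,
and their errors are absorbed into a small tangential change of `δ_bc`. -/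
theorem linReduced_denseRange (hρ : Irrational ρ) (hf : IsC1Field f)
    (hv : IsTorusSolution f T ρ p v) (hV : IsVariationalSolution f T p v V)
    (hq : IsNormallyHyperbolic ρ v V qτ qφ) (hK : (phaseMatrix v K).det ≠ 0) :
    DenseRange (linReduced hf T ρ p hv.c1 K H) := by
  have hV' := hV.isFundamental hf hv.c1
  obtain ⟨hrτ, hrφ⟩ := hq.isCotangent hf hv hV
  rw [Metric.denseRange_iff]
  intro y ε hε
  have hmc : Continuous fun φ => deltaRhs V y.1.1 y.1.2.1 φ + PMat f T p v V φ 1 y.2 :=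
    (continuous_deltaRhs hV' _ _).add ((continuous_PMat hf hv.c1 hV').clm_apply continuous_const)
  let eτ : C(Circ, Vec n) := ⟨fun φ => dtau v φ 1,
    continuous_circle_of_prod (hv.isTangent_dtau hf).cont 1⟩
  let eφ : C(Circ, Vec n) := ⟨fun φ => dphi v φ 1,
    continuous_circle_of_prod (hv.isTangent_dphi hf).cont 1⟩
  have hB : 0 < ‖eτ‖ + ‖eφ‖ + 1 := by positivity
  obtain ⟨a, c, ha⟩ := exists_approx_coboundary hρ
    ⟨fun φ => qτ φ 1 (deltaRhs V y.1.1 y.1.2.1 φ + PMat f T p v V φ 1 y.2),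
      (continuous_circle_of_prod hrτ.cont 1).clm_apply hmc⟩ (div_pos hε hB)
  obtain ⟨b, d, hb⟩ := exists_approx_coboundary hρ
    ⟨fun φ => qφ φ 1 (deltaRhs V y.1.1 y.1.2.1 φ + PMat f T p v V φ 1 y.2),
      (continuous_circle_of_prod hrφ.cont 1).clm_apply hmc⟩ (div_pos hε hB)
  simp only [ContinuousMap.coe_mk] at ha hb
  set α : Circ → ℝ := fun φ => a (φ + (ρ : Circ)) - a φ + c
    - qτ φ 1 (deltaRhs V y.1.1 y.1.2.1 φ + PMat f T p v V φ 1 y.2) with hα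
  set β : Circ → ℝ := fun φ => b (φ + (ρ : Circ)) - b φ + d
    - qφ φ 1 (deltaRhs V y.1.1 y.1.2.1 φ + PMat f T p v V φ 1 y.2) with hβ
  have hαc : Continuous α := ((((map_continuous a).comp (by fun_prop)).sub
    (map_continuous a)).add continuous_const).sub
    ((continuous_circle_of_prod hrτ.cont 1).clm_apply hmc)
  have hβc : Continuous β := ((((map_continuous b).comp (by fun_prop)).sub
    (map_continuous b)).add continuous_const).sub
    ((continuous_circle_of_prod hrφ.cont 1).clm_apply hmc)
  -- By duality at `τ = 1` the rows `q_τ` and `q_φ` read off exactly `α` and `β` from `κ`, so the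
  -- corrected equations hold exactly.
  let κ : C(Circ, Vec n) := ⟨fun φ => α φ • eτ φ + β φ • eφ φ,
    (hαc.smul (map_continuous eτ)).add (hβc.smul (map_continuous eφ))⟩
  have hκ : ∀ φ, deltaRhs V y.1.1 (y.1.2.1 + κ) φ + PMat f T p v V φ 1 y.2 =
      deltaRhs V y.1.1 y.1.2.1 φ + PMat f T p v V φ 1 y.2 + (α φ • dtau v φ 1 + β φ • dphi v φ 1) := by
    intro φ
    simp only [deltaRhs, ContinuousMap.add_apply, κ, ContinuousMap.coe_mk, eτ, eφ]
    abel
  obtain ⟨x, hx⟩ := exists_preimage (K := K) (H := H) hf hv hV hq hK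
    ((y.1.1, y.1.2.1 + κ, y.1.2.2), y.2) (a := a) (b := b) (c := c) (d := d)
    (fun φ => by
      simp only [hκ]
      rw [map_add, map_add _ (_ • _), map_smul, map_smul, (hq.dual_dtau φ 1).1,
        (hq.dual_dphi φ 1).1, hα]
      simp)
    (fun φ => by
      simp only [hκ]
      rw [map_add, map_add _ (_ • _), map_smul, map_smul, (hq.dual_dtau φ 1).2,
        (hq.dual_dphi φ 1).2, hβ]
      simp)
  refine ⟨x, ?_⟩
  have e : y - ((y.1.1, y.1.2.1 + κ, y.1.2.2), y.2) = ((0, -κ, 0), 0) := by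
    refine Prod.ext (Prod.ext ?_ (Prod.ext ?_ ?_)) ?_ <;> simp
  rw [hx, dist_eq_norm, e]
  simp only [Prod.norm_mk, norm_neg, norm_zero]
  have hκn : ‖κ‖ ≤ ε / (‖eτ‖ + ‖eφ‖ + 1) * (‖eτ‖ + ‖eφ‖) := by
    rw [ContinuousMap.norm_le _ (by positivity)]
    intro φ
    change ‖α φ • eτ φ + β φ • eφ φ‖ ≤ _
    rw [mul_add]
    refine (norm_add_le _ _).trans (add_le_add ?_ ?_)
    · rw [norm_smul]
      exact mul_le_mul (ha φ) (eτ.norm_coe_le_norm φ) (norm_nonneg _) (by positivity)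
    · rw [norm_smul]
      exact mul_le_mul (hb φ) (eφ.norm_coe_le_norm φ) (norm_nonneg _) (by positivity)
  have hlt : ‖κ‖ < ε := by
    refine hκn.trans_lt ?_
    rw [div_mul_eq_mul_div, div_lt_iff₀ hB]
    nlinarith
  simp [hlt]

end Solvability

/-! ### Large variations with small data -/

section Unbounded

/-- The trigonometric polynomial `∑ c_j cos(2πkφ)^j`. -/
noncomputable def cosPoly (m : ℕ) (k : ℤ) : (Fin m → ℝ) →ₗ[ℝ] C(Circ, ℝ) :=
  Fintype.linearCombination ℝ fun j : Fin m =>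
    (⟨fun φ => (fourier (-k) φ).re,
      Complex.continuous_re.comp (map_continuous (fourier (-k)))⟩ : C(Circ, ℝ)) ^ (j : ℕ)

theorem cosPoly_apply (m : ℕ) (k : ℤ) (c : Fin m → ℝ) (φ : Circ) :
    cosPoly m k c φ = ∑ j, c j * (fourier (-k) φ).re ^ (j : ℕ) := by
  simp [cosPoly, Fintype.linearCombination_apply, ContinuousMap.sum_apply]

theorem re_fourier_neg (k : ℤ) (s : ℝ) :
    (fourier (-k) (s : Circ)).re = Real.cos (2 * Real.pi * k * s) := by
  rw [fourier_coe_apply]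
  have e : 2 * (Real.pi : ℂ) * Complex.I * ((-k : ℤ) : ℂ) * s / ((1 : ℝ) : ℂ) =
      ((-(2 * Real.pi * k * s) : ℝ) : ℂ) * Complex.I := by
    push_cast
    ring
  rw [e, Complex.exp_ofReal_mul_I_re, Real.cos_neg]

theorem abs_re_fourier_le (k : ℤ) (φ : Circ) : |(fourier k φ).re| ≤ 1 := by
  refine (Complex.abs_re_le_norm _).trans ?_
  have := (fourier k : C(Circ, ℂ)).norm_coe_le_norm φ
  rwa [fourier_norm] at this

/-- The cosine fills `[-1, 1]` for every `k ≠ 0`, so lower bounds for polynomials in it do not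
depend on the frequency. -/
theorem exists_re_fourier_eq {k : ℤ} (hk : k ≠ 0) {x : ℝ} (hx : x ∈ Icc (-1 : ℝ) 1) :
    ∃ φ : Circ, (fourier (-k) φ).re = x := by
  refine ⟨((Real.arccos x / (2 * Real.pi * k) : ℝ) : Circ), ?_⟩
  have hk' : (k : ℝ) ≠ 0 := by exact_mod_cast hk
  rw [re_fourier_neg, mul_div_cancel₀ _ (by positivity), Real.cos_arccos hx.1 hx.2]

theorem abs_re_fourier_translate_sub_le (k : ℤ) (φ : Circ) (ρ : ℝ) :
    |(fourier (-k) (φ + (ρ : Circ))).re - (fourier (-k) φ).re| ≤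
      ‖(1 : ℂ) - Complex.exp (-(2 * Real.pi * Complex.I * k * ρ))‖ := by
  have e : Complex.exp (2 * Real.pi * Complex.I * ((-k : ℤ) : ℂ) * ρ) =
      Complex.exp (-(2 * Real.pi * Complex.I * k * ρ)) := by
    congr 1
    push_cast
    ring
  rw [← Complex.sub_re, fourier_translate, e, ← sub_one_mul]
  refine (Complex.abs_re_le_norm _).trans ?_
  rw [norm_mul, norm_sub_rev]
  refine mul_le_of_le_one_right (norm_nonneg _) ?_
  have := (fourier (-k) : C(Circ, ℂ)).norm_coe_le_norm φ
  rwa [fourier_norm] at this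

theorem abs_cosPoly_translate_sub_le (m : ℕ) (k : ℤ) (c : Fin m → ℝ) (φ : Circ) (ρ : ℝ) :
    |cosPoly m k c (φ + (ρ : Circ)) - cosPoly m k c φ| ≤
      m * (‖c‖ * (‖(1 : ℂ) - Complex.exp (-(2 * Real.pi * Complex.I * k * ρ))‖ * m)) := by
  rw [cosPoly_apply, cosPoly_apply, ← Finset.sum_sub_distrib]
  refine (Finset.abs_sum_le_sum_abs _ _).trans ?_
  have h : ∀ j ∈ (Finset.univ : Finset (Fin m)),
      |c j * (fourier (-k) (φ + (ρ : Circ))).re ^ (j : ℕ) - c j * (fourier (-k) φ).re ^ (j : ℕ)| ≤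
      ‖c‖ * (‖(1 : ℂ) - Complex.exp (-(2 * Real.pi * Complex.I * k * ρ))‖ * m) := by
    intro j _
    rw [← mul_sub, abs_mul]
    refine mul_le_mul (norm_le_pi_norm c j) ?_ (abs_nonneg _) (norm_nonneg _)
    refine (abs_pow_sub_pow_le _ _ _).trans ?_
    have h1 : max |(fourier (-k) (φ + (ρ : Circ))).re| |(fourier (-k) φ).re| ^ ((j : ℕ) - 1) ≤ 1 :=
      pow_le_one₀ (le_max_of_le_left (abs_nonneg _))
        (max_le (abs_re_fourier_le _ _) (abs_re_fourier_le _ _))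
    refine (mul_le_of_le_one_right (by positivity) h1).trans ?_
    exact mul_le_mul (abs_re_fourier_translate_sub_le k φ ρ) (by exact_mod_cast j.2.le)
      (by positivity) (norm_nonneg _)
  refine (Finset.sum_le_card_nsmul _ _ _ h).trans (le_of_eq ?_)
  simp

/-- The coefficients of a polynomial are controlled by its values on `[-1,1]`. -/
theorem exists_norm_le_polynomial_value (m : ℕ) : ∃ B : ℝ, 0 < B ∧ ∀ c : Fin m → ℝ, c ≠ 0 →
    ∃ x ∈ Icc (-1 : ℝ) 1, ‖c‖ ≤ B * |∑ j, c j * x ^ (j : ℕ)| := by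
  -- Any `m` distinct nodes in `[-1, 1]` serve: the Vandermonde matrix is injective and hence
  -- bounded below.
  let t : Fin m → ℝ := fun i => 1 / ((i : ℝ) + 1)
  have ht : Function.Injective t := by
    intro i j hij
    have : (i : ℝ) + 1 = (j : ℝ) + 1 := by
      simpa [t] using hij
    exact Fin.ext (by exact_mod_cast add_right_cancel this)
  let F : (Fin m → ℝ) →ₗ[ℝ] (Fin m → ℝ) := (Matrix.vandermonde t).mulVecLin
  have hF : ∀ c i, F c i = ∑ j, c j * t i ^ (j : ℕ) := by
    intro c i
    simp [F, Matrix.mulVec, dotProduct, Matrix.vandermonde_apply, mul_comm]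
  have hker : LinearMap.ker F = ⊥ := by
    rw [LinearMap.ker_eq_bot']
    intro c hc
    exact Matrix.eq_zero_of_mulVec_eq_zero (Matrix.det_vandermonde_ne_zero_iff.2 ht) hc
  obtain ⟨B, hB, hanti⟩ := F.exists_antilipschitzWith hker
  refine ⟨B, hB, fun c hc => ?_⟩
  have hm : Nonempty (Fin m) := by
    by_contra h
    rw [not_nonempty_iff] at h
    exact hc (Subsingleton.elim _ _)
  have h1 : ‖c‖ ≤ B * ‖F c‖ := by
    have := hanti.le_mul_dist c 0
    simpa using this
  obtain ⟨i, hi⟩ : ∃ i, ‖F c‖ = ‖F c i‖ := by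
    obtain ⟨i, -, hi⟩ := Finset.exists_mem_eq_sup' (Finset.univ_nonempty (α := Fin m))
      (fun i => ‖F c i‖)
    refine ⟨i, le_antisymm ((pi_norm_le_iff_of_nonneg (norm_nonneg _)).2 fun j => ?_)
      (norm_le_pi_norm _ _)⟩
    rw [← hi]
    exact Finset.le_sup' (fun i => ‖F c i‖) (Finset.mem_univ j)
  refine ⟨t i, ⟨?_, ?_⟩, ?_⟩
  · have : 0 ≤ t i := by positivity
    linarith
  · exact div_le_one_of_le₀ (by linarith [(Nat.cast_nonneg (i : ℕ) : (0 : ℝ) ≤ (i : ℕ))])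
      (by positivity)
  · rw [← hF, ← Real.norm_eq_abs, ← hi]
    exact h1

variable {f : Vec n → Vec q → Vec n} {T ρ : ℝ} {p : Vec q} {v : Circ → ℝ → Vec n}
  {V : Circ → ℝ → Vec n →L[ℝ] Vec n} {qτ qφ : Circ → ℝ → Cov n}
  {K : Fin 2 → C(Strip, Cov n)} {H : Fin 2 → Cov q}

theorem isC1_cosPoly_smul_dtau (hf : IsC1Field f) (hv : IsTorusSolution f T ρ p v) (m : ℕ) (k : ℤ)
    (c : Fin m → ℝ) : IsC1 fun φ τ => cosPoly m k c φ • dtau v φ τ := by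
  have hv1 : ContDiff ℝ 1 fun z : ℝ × ℝ => v (z.1 : Circ) z.2 := hv.c1
  have hf1 : ContDiff ℝ 1 fun z : Vec n × Vec q => f z.1 z.2 := hf
  have h1 : ContDiff ℝ 1 fun z : ℝ × ℝ => f (v (z.1 : Circ) z.2) p :=
    hf1.comp (hv1.prodMk contDiff_const)
  simp only [IsC1, hv.dtau_eq, cosPoly_apply, re_fourier_neg]
  have h2 : ContDiff ℝ 1 fun z : ℝ × ℝ =>
      ∑ j : Fin m, c j * Real.cos (2 * Real.pi * k * z.1) ^ (j : ℕ) :=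
    ContDiff.sum fun j _ => by fun_prop
  exact h2.smul (h1.const_smul T)

/-- Small data along continuously differentiable variations with large norm, subject to finitely
many linear conditions. -/
theorem exists_large_unknown (hf : IsC1Field f)
    (hv : IsTorusSolution f T ρ p v) (hq : IsNormallyHyperbolic ρ v V qτ qφ)
    {d : ℕ} (ψ : Unknowns n q →ₗ[ℝ] EuclideanSpace ℝ (Fin d)) (C : ℝ) :
    ∃ x : Unknowns n q, (∃ w : Circ → ℝ → Vec n, IsC1 w ∧ ∀ (φ : Circ) (τ : unitInterval),
        x.1.1.1 (φ, τ) = w φ τ) ∧ x.2 = 0 ∧ ψ x = 0 ∧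
      ‖linZero hf T ρ p hv.c1 K H x‖ ≤ 1 ∧ C < ‖x.1.1.1‖ := by
  have hA := continuous_coeff (T := T) (p := p) hf hv.c1
  have ht := hv.isTangent_dtau hf
  let eτ : C(Circ, Vec n) := ⟨fun φ => dtau v φ 1, continuous_circle_of_prod ht.cont 1⟩
  let Q : C(Circ, Cov n) := ⟨fun φ => qτ φ 0, continuous_circle_of_prod hq.cont_qτ 0⟩
  -- One more coefficient than the `2` phase conditions and `d` extra conditions together.
  set m := d + 3 with hm
  obtain ⟨B, hB, hpoly⟩ := exists_norm_le_polynomial_value m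
  -- The size of the coefficient vector is fixed before `k`, since the kernel vector found below
  -- depends on `k`. The factor `B` pays for passing to a value of the polynomial, and `‖Q‖ + 1` for
  -- reading the amplitude off `δ_v`.
  set S : ℝ := B * ((‖Q‖ + 1) * (|C| + 1)) with hS
  have hS0 : 0 < S := by positivity
  -- The threshold makes the bound of `abs_cosPoly_translate_sub_le` times `‖∂_τ v(·, 1)‖` at most
  -- one.
  obtain ⟨k, hk, hsmall⟩ := exists_small_divisor ρ
    (ε := 1 / (m * (S * m) * (‖eτ‖ + 1))) (by positivity)
  set δ := ‖(1 : ℂ) - Complex.exp (-(2 * Real.pi * Complex.I * k * ρ))‖ with hδ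
  let X : (Fin m → ℝ) →ₗ[ℝ] Unknowns n q := tangentUnknown q hA ht ∘ₗ cosPoly m k
  let P : (Fin m → ℝ) →ₗ[ℝ] EuclideanSpace ℝ (Fin 2) × EuclideanSpace ℝ (Fin d) :=
    ((LinearMap.snd ℝ _ _ ∘ₗ LinearMap.snd ℝ _ _ ∘ₗ linZero hf T ρ p hv.c1 K H).prod ψ) ∘ₗ X
  obtain ⟨c₀, hc₀, hc₀0⟩ := (Submodule.ne_bot_iff _).1
    (LinearMap.ker_ne_bot_of_finrank_lt (f := P) (by simp [hm]; omega))
  set c : Fin m → ℝ := (S / ‖c₀‖) • c₀ with hc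
  have hcn : ‖c‖ = S := by
    rw [hc, norm_smul, norm_div, norm_norm, Real.norm_of_nonneg hS0.le,
      div_mul_cancel₀ _ (norm_ne_zero_iff.2 hc₀0)]
  have hc0 : c ≠ 0 := by
    rw [← norm_ne_zero_iff, hcn]
    exact hS0.ne'
  have hP : P c = 0 := by
    rw [hc, map_smul, LinearMap.mem_ker.1 hc₀, smul_zero]
  have hps : linPs K H (X c) = 0 := congr_arg Prod.fst hP
  have hψ : ψ (X c) = 0 := congr_arg Prod.snd hP
  have hode : linOde hf T p hv.c1 (X c) = 0 := linOde_tangentUnknown hf hv.c1 hA ht _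
  have hbc : ‖linBc ρ hv.c1 (X c)‖ ≤ 1 := by
    rw [ContinuousMap.norm_le _ zero_le_one]
    intro φ
    have e : linBc ρ hv.c1 (X c) φ =
        (cosPoly m k c (φ + (ρ : Circ)) - cosPoly m k c φ) • dtau v φ 1 :=
      linBc_tangentUnknown hv.c1 hA ht _ φ
    rw [e, norm_smul, Real.norm_eq_abs]
    have h1 := abs_cosPoly_translate_sub_le m k c φ ρ
    rw [hcn, ← hδ] at h1
    have h2 : ‖dtau v φ 1‖ ≤ ‖eτ‖ + 1 :=
      (eτ.norm_coe_le_norm φ).trans (le_add_of_nonneg_right zero_le_one)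
    refine (mul_le_mul h1 h2 (norm_nonneg _) (by positivity)).trans ?_
    rw [lt_div_iff₀ (by positivity)] at hsmall
    linarith [hsmall]
  refine ⟨X c, ⟨fun φ τ => cosPoly m k c φ • dtau v φ τ, isC1_cosPoly_smul_dtau hf hv m k c,
    fun φ τ => rfl⟩, rfl, hψ, ?_, ?_⟩
  · change ‖(linOde hf T p hv.c1 (X c), linBc ρ hv.c1 (X c), linPs K H (X c))‖ ≤ 1
    rw [hode, hps]
    simpa [Prod.norm_mk] using hbc
  · obtain ⟨s, hs, hsc⟩ := hpoly c hc0
    obtain ⟨φ, hφ⟩ := exists_re_fourier_eq hk hs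
    have h1 : cosPoly m k c φ = ∑ j, c j * s ^ (j : ℕ) := by rw [cosPoly_apply, hφ]
    have h2 : Q φ ((X c).1.1.1 (φ, 0)) = cosPoly m k c φ := by
      change qτ φ 0 (cosPoly m k c φ • dtau v φ (0 : unitInterval)) = _
      rw [Icc.coe_zero, map_smul, (hq.dual_dtau φ 0).1, smul_eq_mul, mul_one]
    have h3 : |cosPoly m k c φ| ≤ ‖Q‖ * ‖(X c).1.1.1‖ := by
      rw [← h2, ← Real.norm_eq_abs]
      exact ((Q φ).le_opNorm _).trans (mul_le_mul (Q.norm_coe_le_norm φ)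
        ((X c).1.1.1.norm_coe_le_norm _) (norm_nonneg _) (norm_nonneg Q))
    rw [hcn, ← h1, hS, mul_le_mul_iff_right₀ hB] at hsc
    have h4 : (‖Q‖ + 1) * (|C| + 1) ≤ (‖Q‖ + 1) * ‖(X c).1.1.1‖ :=
      hsc.trans (h3.trans (mul_le_mul_of_nonneg_right (le_add_of_nonneg_right zero_le_one)
        (norm_nonneg _)))
    have h5 := le_of_mul_le_mul_left h4 (by positivity)
    linarith [le_abs_self C]

theorem exists_bound_of_continuous {E F : Type*} [NormedAddCommGroup E] [NormedSpace ℝ E]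
    [NormedAddCommGroup F] [NormedSpace ℝ F] (M : E → F) (hadd : ∀ x y, M (x + y) = M x + M y)
    (hsmul : ∀ (c : ℝ) x, M (c • x) = c • M x) (hM : Continuous M) :
    ∃ B, 0 < B ∧ ∀ y, ‖M y‖ ≤ B * ‖y‖ :=
  ContinuousLinearMap.bound
    ({ toFun := M, map_add' := hadd, map_smul' := hsmul, cont := hM } : E →L[ℝ] F)

end Unbounded

end QPTorus

/-! ### Assembly of the theorem -/

open QPTorus in
theorem mainTheorem3 {n q : ℕ} (f : Vec n → Vec q → Vec n) (hf : IsC1Field f)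
    (T ρ : ℝ) (hρ : Irrational ρ) (p : Vec q)
    (v : Circ → ℝ → Vec n) (hv : IsTorusSolution f T ρ p v)
    (V : Circ → ℝ → Vec n →L[ℝ] Vec n) (hV : IsVariationalSolution f T p v V)
    (qτ qφ : Circ → ℝ → Cov n) (hq : IsNormallyHyperbolic ρ v V qτ qφ)
    (h : (Strip → Vec n) → Vec q → Fin 2 → ℝ)
    (K : Fin 2 → C(Strip, Cov n)) (H : Fin 2 → Cov q) (hh : IsPhaseCondition h p v K H) :
    -- small divisors: nonzero, but arbitrarily small
    ((∀ k : ℤ, k ≠ 0 → (1 : ℂ) - Complex.exp (-(2 * Real.pi * Complex.I * k * ρ)) ≠ 0) ∧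
      ∀ ε : ℝ, 0 < ε → ∃ k : ℤ, k ≠ 0 ∧
        ‖(1 : ℂ) - Complex.exp (-(2 * Real.pi * Complex.I * k * ρ))‖ < ε) ∧
    -- they are the divisors in the equations for the Fourier coefficients of the tangential
    -- components of `δ_v(·, 0)`
    (∀ (x : Unknowns n q) (k : ℤ), k ≠ 0 → ∀ r ∈ ({qτ, qφ} : Set (Circ → ℝ → Cov n)),
      ((1 : ℂ) - Complex.exp (-(2 * Real.pi * Complex.I * k * ρ))) *
          fourierCoeff (fun φ : Circ => ((r φ 0 (x.1.1.1 (φ, 0)) : ℝ) : ℂ)) k =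
        fourierCoeff (fun φ : Circ => ((r φ 0
          (deltaRhs V (linOde hf T p hv.c1 x) (linBc ρ hv.c1 x) (φ - (ρ : Circ))
            + PMat f T p v V (φ - (ρ : Circ)) 1 x.2.2.2) : ℝ) : ℂ)) k) ∧
    -- the linearization has a densely defined inverse
    Function.Injective (linReduced hf T ρ p hv.c1 K H) ∧
    DenseRange (linReduced hf T ρ p hv.c1 K H) ∧
    -- this inverse is unbounded, even as a map into the continuous functions with sup-norm and
    -- along continuously differentiable `δ_v`
    (∀ C : ℝ, ∃ x : Unknowns n q,
      (∃ w : Circ → ℝ → Vec n, IsC1 w ∧ ∀ (φ : Circ) (τ : unitInterval),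
        x.1.1.1 (φ, τ) = w φ τ) ∧
      ‖linReduced hf T ρ p hv.c1 K H x‖ ≤ 1 ∧ C < ‖x.1.1.1‖) ∧
    (¬ ∃ M : Violations n × Vec q →L[ℝ] Unknowns n q,
      (∀ x, M (linReduced hf T ρ p hv.c1 K H x) = x) ∧
      ∀ y, linReduced hf T ρ p hv.c1 K H (M y) = y) ∧
    -- the zero problem is not regular, whatever finitely many scalar conditions are appended
    (∀ (d : ℕ) (ψ : Unknowns n q →L[ℝ] EuclideanSpace ℝ (Fin d)),
      ¬ ∃ M : Violations n × EuclideanSpace ℝ (Fin d) →L[ℝ] Unknowns n q,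
        (∀ x, M (linZero hf T ρ p hv.c1 K H x, ψ x) = x) ∧
        ∀ y, (linZero hf T ρ p hv.c1 K H (M y), ψ (M y)) = y) ∧
    -- the mean equations for `δ_T` and `δ_ρ`
    (∀ x : Unknowns n q,
      (∫ φ : Circ, qτ (φ - (ρ : Circ)) 1
          (deltaRhs V (linOde hf T p hv.c1 x) (linBc ρ hv.c1 x) (φ - (ρ : Circ))))
        + (∫ φ : Circ, (qτ (φ - (ρ : Circ)) 1).comp (PMat f T p v V (φ - (ρ : Circ)) 1)) x.2.2.2
        = -(x.2.1 / T) ∧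
      (∫ φ : Circ, qφ (φ - (ρ : Circ)) 1
          (deltaRhs V (linOde hf T p hv.c1 x) (linBc ρ hv.c1 x) (φ - (ρ : Circ))))
        + (∫ φ : Circ, (qφ (φ - (ρ : Circ)) 1).comp (PMat f T p v V (φ - (ρ : Circ)) 1)) x.2.2.2
        = x.2.2.1) ∧
    -- existence and uniqueness of the adjoint variables
    (∀ (ldE : Circ → ℝ → Cov n) (lbc : C(Circ, Cov n)) (lps : Fin 2 → ℝ) (etap : Cov q),
      (IsAdjointSolution f T ρ p v K H ldE lbc lps 1 0 etap ↔
        (∀ φ, ∀ τ ∈ Set.Icc (0 : ℝ) 1, ldE φ τ = T • qτ φ τ) ∧ (∀ φ, lbc φ = T • qτ φ 1) ∧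
        lps = 0 ∧ etap = T • ∫ φ : Circ, (qτ φ 1).comp (PMat f T p v V φ 1)) ∧
      (IsAdjointSolution f T ρ p v K H ldE lbc lps 0 1 etap ↔
        (∀ φ, ∀ τ ∈ Set.Icc (0 : ℝ) 1, ldE φ τ = -qφ φ τ) ∧ (∀ φ, lbc φ = -qφ φ 1) ∧
        lps = 0 ∧ etap = -∫ φ : Circ, (qφ φ 1).comp (PMat f T p v V φ 1))) ∧
    -- the rows of the inverse giving `δ_T` and `δ_ρ` are bounded and are given by the adjoint
    -- variables; the sensitivity to the phase conditions vanishes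
    (∃ RT Rρ : Violations n × Vec q →L[ℝ] ℝ,
      (∀ x, RT (linReduced hf T ρ p hv.c1 K H x) = x.2.1) ∧
      (∀ x, Rρ (linReduced hf T ρ p hv.c1 K H x) = x.2.2.1) ∧
      (∀ (ldE : Circ → ℝ → Cov n) (lbc : C(Circ, Cov n)) (lps : Fin 2 → ℝ) (etap : Cov q),
        IsAdjointSolution f T ρ p v K H ldE lbc lps 1 0 etap →
          ∀ y, RT y = -adjointPairing ldE lbc lps etap y) ∧
      (∀ (ldE : Circ → ℝ → Cov n) (lbc : C(Circ, Cov n)) (lps : Fin 2 → ℝ) (etap : Cov q),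
        IsAdjointSolution f T ρ p v K H ldE lbc lps 0 1 etap →
          ∀ y, Rρ y = -adjointPairing ldE lbc lps etap y) ∧
      (∀ δp : Vec q,
        RT (0, δp) = -((T • ∫ φ : Circ, (qτ φ 1).comp (PMat f T p v V φ 1)) δp) ∧
        Rρ (0, δp) = -((-∫ φ : Circ, (qφ φ 1).comp (PMat f T p v V φ 1)) δp)) ∧
      (∀ δh : EuclideanSpace ℝ (Fin 2),
        RT ((0, 0, δh), 0) = 0 ∧ Rρ ((0, 0, δh), 0) = 0)) := by 
  have hK : (phaseMatrix v K).det ≠ 0 := hh.nondegenerate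
  have hT := hq.T_ne_zero hv
  obtain ⟨hrτ, hrφ⟩ := hq.isCotangent hf hv hV
  have hττ : ∀ φ, qτ φ 0 (dtau v φ 0) = 1 := fun φ => (hq.dual_dtau φ 0).1
  have hφτ : ∀ φ, qφ φ 0 (dtau v φ 0) = 0 := fun φ => (hq.dual_dtau φ 0).2
  have hτφ : ∀ φ, qτ φ 0 (dphi v φ 0) = 0 := fun φ => (hq.dual_dphi φ 0).1
  have hφφ : ∀ φ, qφ φ 0 (dphi v φ 0) = 1 := fun φ => (hq.dual_dphi φ 0).2
  -- The general row field `T η_T q_τ - η_ρ q_φ` at `(η_T, η_ρ) = (1, 0)`, and below at `(0, 1)`.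
  have hrT : (fun φ τ => T • qτ φ τ) =
      fun φ τ => (T * 1) • qτ φ τ + (-0 : ℝ) • qφ φ τ := by
    funext φ τ
    rw [mul_one, neg_zero, zero_smul, add_zero]
  have hrρ : (fun φ τ => -qφ φ τ) =
      fun φ τ => (T * 0) • qτ φ τ + (-1 : ℝ) • qφ φ τ := by
    funext φ τ
    ext x
    simp
  have heT : ∫ φ : Circ, (T • qτ φ 1).comp (PMat f T p v V φ 1) =
      T • ∫ φ : Circ, (qτ φ 1).comp (PMat f T p v V φ 1) := by
    rw [← integral_smul]
    rfl
  have heρ : ∫ φ : Circ, (-qφ φ 1).comp (PMat f T p v V φ 1) =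
      -∫ φ : Circ, (qφ φ 1).comp (PMat f T p v V φ 1) := by
    rw [← integral_neg]
    simp only [ContinuousLinearMap.neg_comp]
  refine ⟨⟨fun k hk => small_divisor_ne_zero hρ hk, fun ε hε => exists_small_divisor ρ hε⟩,
    ?_, linReduced_injective hρ hf hv hV hq K H hK, linReduced_denseRange hρ hf hv hV hq hK,
    ?_, ?_, ?_, ?_, ?_, ?_⟩
  · rintro x k hk r (rfl | rfl)
    · exact hrτ.fourierCoeff_eq hf hv hV hT hττ hτφ x hk
    · exact hrφ.fourierCoeff_eq hf hv hV hT hφτ hφφ x hk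
  · intro C
    -- With `d = 0` no condition is appended. The variation has `δ_p = 0`, so prescribing `p` adds
    -- nothing to the data.
    obtain ⟨x, hx1, hx2, -, hx3, hx4⟩ := exists_large_unknown (K := K) (H := H) hf hv hq
      (0 : Unknowns n q →ₗ[ℝ] EuclideanSpace ℝ (Fin 0)) C
    refine ⟨x, hx1, ?_, hx4⟩
    change ‖(linZero hf T ρ p hv.c1 K H x, x.2.2.2)‖ ≤ 1
    rw [hx2]
    simpa [Prod.norm_mk] using hx3
  · rintro ⟨M, hM, -⟩
    obtain ⟨B, hB, hMB⟩ := exists_bound_of_continuous M M.map_add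
      (fun c y => M.map_smul c y) M.continuous
    obtain ⟨x, -, hx2, -, hx3, hx4⟩ := exists_large_unknown (K := K) (H := H) hf hv hq
      (0 : Unknowns n q →ₗ[ℝ] EuclideanSpace ℝ (Fin 0)) B
    have h1 : ‖linReduced hf T ρ p hv.c1 K H x‖ ≤ 1 := by
      change ‖(linZero hf T ρ p hv.c1 K H x, x.2.2.2)‖ ≤ 1
      rw [hx2]
      simpa [Prod.norm_mk] using hx3
    have h2 := (hMB _).trans (mul_le_of_le_one_right hB.le h1)
    rw [hM] at h2
    exact absurd (hx4.trans_le ((norm_fst_le x.1.1).trans ((norm_fst_le x).trans h2)))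
      (lt_irrefl _)
  · rintro d ψ ⟨M, hM, -⟩
    obtain ⟨B, hB, hMB⟩ := exists_bound_of_continuous M M.map_add
      (fun c y => M.map_smul c y) M.continuous
    obtain ⟨x, -, hx2, hx5, hx3, hx4⟩ := exists_large_unknown (K := K) (H := H) hf hv hq
      (ψ : Unknowns n q →ₗ[ℝ] EuclideanSpace ℝ (Fin d)) B
    have h1 : ‖(linZero hf T ρ p hv.c1 K H x, ψ x)‖ ≤ 1 := by
      rw [show ψ x = 0 from hx5]
      simpa [Prod.norm_mk] using hx3
    have h2 := (hMB _).trans (mul_le_of_le_one_right hB.le h1)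
    rw [hM] at h2
    exact absurd (hx4.trans_le ((norm_fst_le x.1.1).trans ((norm_fst_le x).trans h2)))
      (lt_irrefl _)
  · intro x
    refine ⟨(hrτ.mean_translate hf hv hV hT hττ hτφ x).trans (by ring),
      (hrφ.mean_translate hf hv hV hT hφτ hφφ x).trans (by ring)⟩
  · intro ldE lbc lps etap
    rw [← heT, ← heρ]
    exact ⟨isAdjointSolution_iff hρ hf hv hV hq hK hrT, isAdjointSolution_iff hρ hf hv hV hq hK hrρ⟩
  · obtain ⟨RT, hT1, hT2, hT3, hT4⟩ := exists_bounded_row (K := K) (H := H) hρ hf hv hV hq hK hrT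
    obtain ⟨Rρ, hρ1, hρ2, hρ3, hρ4⟩ := exists_bounded_row (K := K) (H := H) hρ hf hv hV hq hK hrρ
    refine ⟨RT, Rρ, fun x => (hT1 x).trans (by ring), fun x => (hρ1 x).trans (by ring), hT2, hρ2,
      fun δp => ?_, fun δh => ⟨hT4 δh, hρ4 δh⟩⟩
    rw [hT3, hρ3, heT, heρ]
    exact ⟨rfl, rfl⟩
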